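/- Let $\mathbb D$ be the open unit disc, $\mathbb T$ the unit circle, $dA=\frac1\pi\,dx\,dy$ the normalized area measure on $\mathbb D$, and $\sigma$ the normalized Lebesgue measure on $\mathbb T$. For $k\ge 1$ and $z,\zeta\in\mathbb D$, $z\neq\zeta$, let $$G_k(z,\zeta)=|\zeta-z|^{2(k-1)}\log\left|\frac{1-z\overline\zeta}{\zeta-z}\right|^2+\sum_{l=1}^{k-1}\frac{(-1)^l}{l}\,|\zeta-z|^{2(k-1-l)}(1-|\zeta|^2)^l(1-|z|^2)^l$$ be the polyharmonic Green–Almansi function; it satisfies $(-1)^{k+1}G_k\ge 0$. For $h$ holomorphic on $\mathbb D$, $k\ge1$ and $\zeta\in\mathbb D$ define the following quantities in $[0,\infty]$: $$D_{\zeta,k}(h)=\frac{1}{((k-1)!)^2}\int_{\mathbb D}|h^{(k)}(z)|^2\,\frac{(-1)^{k+1}G_k(z,\zeta)}{(1-|\zeta|^2)^k}\,dA(z),$$ $$D_{\sigma,k}(h)=\frac{1}{k!\,(k-1)!}\int_{\mathbb D}|h^{(k)}(z)|^2\left(\int_{\mathbb T}\frac{(1-|z|^2)^k}{|z-\xi|^2}\,d\sigma(\xi)\right)dA(z),$$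 $$D_{\sigma,0}(h)=\|h\|_{H^2}^2=\sup_{0<r<1}\int_{\mathbb T}|h(r\xi)|^2\,d\sigma(\xi).$$ Then for every integer $k\ge1$, every $\zeta\in\mathbb D$ and every holomorphic function $f$ on $\mathbb D$, $$D_{\zeta,k}(f)=D_{\sigma,k-1}(g),\qquad g(z)=\frac{f(z)-f(\zeta)}{z-\zeta}\ (z\ne\zeta),\quad g(\zeta)=f'(\zeta),$$ as an equality in $[0,\infty]$ (in particular, one side is finite if and only if the other is). -/

import Mathlib

open MeasureTheory Set Metric
open scoped ENNReal Nat ComplexConjugate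

noncomputable section

namespace HigherDirichlet

/-- The polyharmonic Green–Almansi function `G_k(z, ζ)` of the unit disc, for `k ≥ 1`, `z ≠ ζ`. (On the
diagonal `z = ζ`, where it is not defined for `k = 1`, the value below plays no role: it only
changes integrands on null sets.) -/
def greenAlmansi (k : ℕ) (z ζ : ℂ) : ℝ :=
  ‖ζ - z‖ ^ (2 * (k - 1)) * Real.log (‖(1 - z * conj ζ) / (ζ - z)‖ ^ 2)
    + ∑ l ∈ Finset.Icc 1 (k - 1), (-1 : ℝ) ^ l / (l : ℝ) * ‖ζ - z‖ ^ (2 * (k - 1 - l))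
        * (1 - ‖ζ‖ ^ 2) ^ l * (1 - ‖z‖ ^ 2) ^ l

/-- Normalized Lebesgue area measure `dA = dx dy / π` on the open unit disc. -/
def areaMeasure : Measure ℂ :=
  ENNReal.ofReal (Real.pi⁻¹) • (volume.restrict (ball (0 : ℂ) 1))

/-- Normalized Lebesgue (arc length) measure on the unit circle, as a measure on `ℂ`. -/
def circleMeasure : Measure ℂ :=
  ENNReal.ofReal ((2 * Real.pi)⁻¹) •
    (volume.restrict (Ioc (0 : ℝ) (2 * Real.pi))).map (circleMap 0 1)

/-- The weight `U_{μ,k}` on the disc attached to a measure `μ` carried by the closed unit disc: the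
generalized Green potential of the part of `μ` on the open disc, plus the term
coming from the part of `μ` on the circle. Both integrands are nonnegative on the disc (for the first one
see `greenAlmansi_sign`), so `ENNReal.ofReal` truncates nothing. -/
def weight (μ : Measure ℂ) (k : ℕ) (z : ℂ) : ℝ≥0∞ :=
  ENNReal.ofReal (1 / ((k - 1)! : ℝ) ^ 2) *
      ∫⁻ ζ in ball (0 : ℂ) 1,
        ENNReal.ofReal ((-1 : ℝ) ^ (k + 1) * greenAlmansi k z ζ / (1 - ‖ζ‖ ^ 2) ^ k) ∂μ
    + ENNReal.ofReal (1 / ((k ! : ℝ) * ((k - 1)! : ℝ))) *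
      ∫⁻ ζ in sphere (0 : ℂ) 1,
        ENNReal.ofReal ((1 - ‖z‖ ^ 2) ^ k / ‖z - ζ‖ ^ 2) ∂μ

/-- The weighted Dirichlet integral `D_{μ,k}(f) = ∫_𝔻 |f⁽ᵏ⁾|² U_{μ,k} dA ∈ [0, ∞]`, for `k ≥ 1`. -/
def dirichletIntegral (μ : Measure ℂ) (k : ℕ) (f : ℂ → ℂ) : ℝ≥0∞ :=
  ∫⁻ z, ‖iteratedDeriv k f z‖ₑ ^ 2 * weight μ k z ∂areaMeasure

/-- The local Dirichlet integral `D_{ζ,k}(f)` of order `k ≥ 1` at `ζ`: the case of a unit mass at `ζ`. -/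
def localDirichletIntegral (ζ : ℂ) (k : ℕ) (f : ℂ → ℂ) : ℝ≥0∞ :=
  dirichletIntegral (Measure.dirac ζ) k f

/-- The squared Hardy space norm `‖f‖²_{H²} ∈ [0, ∞]` of a holomorphic function on the disc. -/
def hardyNormSq (f : ℂ → ℂ) : ℝ≥0∞ :=
  ⨆ r ∈ Ioo (0 : ℝ) 1, ∫⁻ ξ, ‖f ((r : ℂ) * ξ)‖ₑ ^ 2 ∂circleMeasure

/-- `D_{σ,k}(f)` for `k ≥ 0`, with `σ` normalized Lebesgue measure on the circle;
`D_{σ,0}(f) = ‖f‖²_{H²}`. -/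
def circleDirichletIntegral (k : ℕ) (f : ℂ → ℂ) : ℝ≥0∞ :=
  if k = 0 then hardyNormSq f else dirichletIntegral circleMeasure k f

lemma log_remainder_sign (n : ℕ) {y : ℝ} (hy : 0 ≤ y) :
    0 ≤ (-1 : ℝ) ^ n * (Real.log (1 + y) + ∑ l ∈ Finset.Icc 1 n, (-1 : ℝ) ^ l / (l : ℝ) * y ^ l) := by
  have hder : ∀ x : ℝ, 0 ≤ x → HasDerivAt (fun x : ℝ => (-1 : ℝ) ^ n *
      (Real.log (1 + x) + ∑ l ∈ Finset.Icc 1 n, (-1 : ℝ) ^ l / (l : ℝ) * x ^ l))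
      (x ^ n / (1 + x)) x := by
    intro x hx
    have h1 : HasDerivAt (fun x : ℝ => Real.log (1 + x)) (1 / (1 + x)) x :=
      ((hasDerivAt_id x).const_add 1).log (by simp only [id]; positivity)
    have h2 : HasDerivAt (fun x : ℝ => ∑ l ∈ Finset.Icc 1 n, (-1 : ℝ) ^ l / (l : ℝ) * x ^ l)
        (∑ l ∈ Finset.Icc 1 n, (-1 : ℝ) ^ l / (l : ℝ) * ((l : ℝ) * x ^ (l - 1))) x :=
      HasDerivAt.fun_sum fun l _ => (hasDerivAt_pow l x).const_mul _
    have hs : ∀ m : ℕ, (1 + x) *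
        (∑ l ∈ Finset.Icc 1 m, (-1 : ℝ) ^ l / (l : ℝ) * ((l : ℝ) * x ^ (l - 1)))
          = -1 + (-1) ^ m * x ^ m := by
      intro m
      induction m with
      | zero => simp
      | succ m ih =>
        rw [Finset.sum_Icc_succ_top (by omega), mul_add, ih]
        have : ((m + 1 : ℕ) : ℝ) ≠ 0 := by positivity
        field_simp
        simp only [Nat.add_sub_cancel]
        ring
    have h3 := (h1.add h2).const_mul ((-1 : ℝ) ^ n)
    refine h3.congr_deriv ?_
    have hx' : (1 + x) ≠ 0 := by positivity
    have hsq : ((-1 : ℝ) ^ n) * (-1) ^ n = 1 := by rw [← mul_pow]; simp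
    rw [eq_div_iff hx', mul_assoc, add_mul, one_div_mul_cancel hx', mul_comm _ (1 + x), hs n]
    linear_combination (x ^ n) * hsq
  have hmono : MonotoneOn (fun x : ℝ => (-1 : ℝ) ^ n *
      (Real.log (1 + x) + ∑ l ∈ Finset.Icc 1 n, (-1 : ℝ) ^ l / (l : ℝ) * x ^ l)) (Ici 0) := by
    refine monotoneOn_of_deriv_nonneg (convex_Ici 0)
      (fun x hx => (hder x hx).continuousAt.continuousWithinAt)
      (fun x hx => (hder x (interior_subset hx)).differentiableAt.differentiableWithinAt) ?_
    intro x hx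
    have hx0 : 0 ≤ x := interior_subset hx
    rw [(hder x hx0).deriv]
    positivity
  have h0 := hmono (mem_Ici.2 le_rfl) (mem_Ici.2 hy) hy
  have hz : ∑ l ∈ Finset.Icc 1 n, (-1 : ℝ) ^ l / (l : ℝ) * (0 : ℝ) ^ l = 0 :=
    Finset.sum_eq_zero fun l hl => by
      rw [zero_pow (by have := (Finset.mem_Icc.1 hl).1; omega), mul_zero]
  simpa [hz] using h0

/-- The function `(-1)^{k+1} G_k(·, ζ)` is nonnegative on the disc. -/
lemma greenAlmansi_sign {k : ℕ} (hk : 1 ≤ k) {z ζ : ℂ} (hz : ‖z‖ < 1) (hζ : ‖ζ‖ < 1) (hne : z ≠ ζ) :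
    0 ≤ (-1 : ℝ) ^ (k + 1) * greenAlmansi k z ζ := by
  obtain ⟨n, rfl⟩ : ∃ n, k = n + 1 := ⟨k - 1, by omega⟩
  have hd : 0 < ‖ζ - z‖ := norm_pos_iff.2 (sub_ne_zero.2 hne.symm)
  have hz1 : 0 < 1 - ‖z‖ ^ 2 := by nlinarith [norm_nonneg z]
  have hζ1 : 0 < 1 - ‖ζ‖ ^ 2 := by nlinarith [norm_nonneg ζ]
  set y : ℝ := (1 - ‖ζ‖ ^ 2) * (1 - ‖z‖ ^ 2) / ‖ζ - z‖ ^ 2 with hy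
  have hkey : ‖(1 - z * conj ζ) / (ζ - z)‖ ^ 2 = 1 + y := by
    rw [norm_div, div_pow, hy]
    field_simp
    simp only [← Complex.normSq_eq_norm_sq, Complex.normSq_apply]
    simp
    ring
  have hG : greenAlmansi (n + 1) z ζ = ‖ζ - z‖ ^ (2 * n) *
      (Real.log (1 + y) + ∑ l ∈ Finset.Icc 1 n, (-1 : ℝ) ^ l / (l : ℝ) * y ^ l) := by
    unfold greenAlmansi
    rw [hkey, mul_add, Finset.mul_sum, Nat.add_sub_cancel]
    congr 1
    refine Finset.sum_congr rfl fun l hl => ?_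
    have hln := (Finset.mem_Icc.1 hl).2
    have hp : ‖ζ - z‖ ^ (2 * n) = ‖ζ - z‖ ^ (2 * (n - l)) * (‖ζ - z‖ ^ 2) ^ l := by
      rw [← pow_mul, ← pow_add]; congr 1; omega
    rw [hp, hy, div_pow, mul_pow]
    field_simp
  rw [hG, pow_add, pow_add]
  have := mul_nonneg (pow_nonneg hd.le (2 * n)) (log_remainder_sign n (y := y) (by positivity))
  linarith

/-- The local Dirichlet integral at a point of the open disc, in explicit form. -/
lemma localDirichletIntegral_eq {ζ : ℂ} (hζ : ‖ζ‖ < 1) (k : ℕ) (f : ℂ → ℂ) :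
    localDirichletIntegral ζ k f = ∫⁻ z, ‖iteratedDeriv k f z‖ₑ ^ 2 *
      (ENNReal.ofReal (1 / ((k - 1)! : ℝ) ^ 2) *
        ENNReal.ofReal ((-1 : ℝ) ^ (k + 1) * greenAlmansi k z ζ / (1 - ‖ζ‖ ^ 2) ^ k))
      ∂areaMeasure := by
  classical
  have hb : ζ ∈ ball (0 : ℂ) 1 := by simpa using hζ
  simp [localDirichletIntegral, dirichletIntegral, weight, setLIntegral_dirac, hb, hζ.ne]

end HigherDirichlet

end

open MeasureTheory Set Metric
open scoped ENNReal Nat ComplexConjugate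

noncomputable section

namespace HigherDirichlet

/-! At ζ = 0 both weights are radial, so by Parseval both integrals are diagonal in the Taylor
coefficients. Writing f - f(0) = z g, the (n+m+1)-st derivative at 0 gains a factor n+m+1 over the
(n+m)-th derivative of g. Its square is exactly what separates the two coefficient formulas
(`localDirichletIntegral_zero`).

The general case is moved to the origin by the automorphism φ(w) = (w + ζ)/q, q = 1 + conj ζ · w.
Put c = 1 - |ζ|². Bol's lemma (`iteratedDeriv_comp_mobius`) says that the weight q^m turns the
(m+1)-st derivative into a covariant operation. The Green–Almansi function is covariant as well
(`greenAlmansi_mobius`), so D_{ζ,m+1}(f) equals c^{-(m+1)} D_{0,m+1}(q^m · f∘φ). Since φ - ζ = c w /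
q, for f - f(ζ) = (z - ζ) g the transported function is c w H with H = q^{m-1} · g∘φ. The case ζ = 0
then leaves c^{1-m} D_{σ,m}(H).

It remains to see that D_{σ,m}(H) = c^{m-1} D_{σ,m}(g). For m ≥ 1 this is Bol's lemma again, one
order lower (`circleDirichletIntegral_mobius`). For m = 0 it is the conformal change of variables in
H², obtained as a limit of weighted Bergman norms (`hardyNormSq_mobius`), which avoids boundary
values. -/

/-! ### Parseval on the circle and, for radial weights, on the disc. -/

lemma integral_circleMap_pow_mul_conj (a : ℝ) (n m : ℕ) :
    ∫ θ in a..(a + 2 * Real.pi), circleMap 0 1 θ ^ n * conj (circleMap 0 1 θ ^ m)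
      = if n = m then ((2 * Real.pi : ℝ) : ℂ) else 0 := by
  have h1 : ∀ θ : ℝ, circleMap 0 1 θ ^ n * conj (circleMap 0 1 θ ^ m)
      = Complex.exp ((((n : ℂ) - m) * Complex.I) * θ) := by
    intro θ
    simp only [circleMap_zero, Complex.ofReal_one, one_mul, ← Complex.exp_conj, map_mul,
      Complex.conj_ofReal, Complex.conj_I, map_natCast, ← Complex.exp_nat_mul, ← Complex.exp_add]
    congr 1
    ring
  simp_rw [h1]
  split_ifs with h
  · subst h
    simp
  · have hne : ((n : ℂ) - m) * Complex.I ≠ 0 :=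
      mul_ne_zero (sub_ne_zero.2 (by exact_mod_cast h)) Complex.I_ne_zero
    rw [integral_exp_mul_complex hne]
    have : ((n : ℂ) - m) * Complex.I * ((a + 2 * Real.pi : ℝ) : ℂ)
        = ((n : ℂ) - m) * Complex.I * a + ((n - m : ℤ) : ℂ) * (2 * Real.pi * Complex.I) := by
      push_cast; ring
    rw [this, Complex.exp_periodic.int_mul]
    simp

lemma hasSum_mul_conj {x : ℕ → ℂ} (hx : Summable fun n => ‖x n‖) :
    HasSum (fun p : ℕ × ℕ => x p.1 * conj (x p.2)) ((∑' n, x n) * conj (∑' n, x n)) := by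
  have hx' : Summable fun n => ‖conj (x n)‖ := by simpa using hx
  have h1 := tsum_mul_tsum_of_summable_norm hx hx'
  have h2 : ∑' n, conj (x n) = conj (∑' n, x n) := (hx.of_norm.hasSum.star).tsum_eq
  rw [← h2, h1]
  exact (summable_mul_of_summable_norm hx hx').hasSum

/-- **Parseval's identity** for an absolutely summable series, over an arc of length `2π`. -/
lemma lintegral_arc_tsum_sq (a : ℝ) {c : ℕ → ℂ} (hc : Summable fun n => ‖c n‖) :
    ∫⁻ θ in Ioc a (a + 2 * Real.pi), ‖∑' n, c n * circleMap 0 1 θ ^ n‖ₑ ^ 2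
      = ENNReal.ofReal (2 * Real.pi) * ∑' n, ‖c n‖ₑ ^ 2 := by
  have hnorm : ∀ (n : ℕ) (θ : ℝ), ‖c n * circleMap 0 1 θ ^ n‖ = ‖c n‖ := fun n θ => by simp
  set F : ℝ → ℂ := fun θ => ∑' n, c n * circleMap 0 1 θ ^ n with hF
  have hFc : Continuous F :=
    continuous_tsum (fun n => by fun_prop) hc fun n θ => (hnorm n θ).le
  have hpi : a ≤ a + 2 * Real.pi := by linarith [Real.pi_pos]
  -- |F|² is expanded as an absolutely convergent double series and integrated termwise;
  -- orthogonality keeps only the diagonal.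
  set u : ℕ × ℕ → ℝ → ℂ := fun p θ =>
    (c p.1 * circleMap 0 1 θ ^ p.1) * conj (c p.2 * circleMap 0 1 θ ^ p.2) with hu
  have hun : ∀ p θ, ‖u p θ‖ = ‖c p.1‖ * ‖c p.2‖ := fun p θ => by
    simp only [hu, norm_mul, RCLike.norm_conj, norm_pow, norm_circleMap_zero]; simp
  have hcc : Summable fun p : ℕ × ℕ => ‖c p.1‖ * ‖c p.2‖ :=
    hc.mul_of_nonneg hc (fun _ => norm_nonneg _) fun _ => norm_nonneg _
  have hsum : ∀ θ, HasSum (fun p => u p θ) (F θ * conj (F θ)) := by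
    intro θ
    exact hasSum_mul_conj (x := fun n => c n * circleMap 0 1 θ ^ n) (by simpa only [hnorm] using hc)
  have hint : ∫ θ in a..(a + 2 * Real.pi), F θ * conj (F θ)
      = ((2 * Real.pi * ∑' n, ‖c n‖ ^ 2 : ℝ) : ℂ) := by
    have h1 : HasSum (fun p => ∫ θ in a..(a + 2 * Real.pi), u p θ)
        (∫ θ in a..(a + 2 * Real.pi), F θ * conj (F θ)) := by
      refine intervalIntegral.hasSum_integral_of_dominated_convergence
        (fun p _ => ‖c p.1‖ * ‖c p.2‖) (fun p => ?_) (fun p => ?_) ?_ ?_ ?_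
      · exact Continuous.aestronglyMeasurable (by fun_prop)
      · exact Filter.Eventually.of_forall fun θ _ => (hun p θ).le
      · exact Filter.Eventually.of_forall fun θ _ => hcc
      · simp
      · exact Filter.Eventually.of_forall fun θ _ => hsum θ
    have h2 : ∀ p, ∫ θ in a..(a + 2 * Real.pi), u p θ
        = if p.1 = p.2 then ((2 * Real.pi * ‖c p.1‖ ^ 2 : ℝ) : ℂ) else 0 := by
      intro p
      have : ∀ θ, u p θ = (c p.1 * conj (c p.2)) *
          (circleMap 0 1 θ ^ p.1 * conj (circleMap 0 1 θ ^ p.2)) := fun θ => by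
        simp only [hu, map_mul]; ring
      simp_rw [this]
      rw [intervalIntegral.integral_const_mul, integral_circleMap_pow_mul_conj]
      split_ifs with h
      · rw [h, Complex.mul_conj, Complex.normSq_eq_norm_sq]; push_cast; ring
      · simp
    have h3 : HasSum (fun n => ((2 * Real.pi * ‖c n‖ ^ 2 : ℝ) : ℂ))
        (∫ θ in a..(a + 2 * Real.pi), F θ * conj (F θ)) := by
      have hinj : Function.Injective (fun n : ℕ => (n, n)) := fun x y h => (Prod.mk.inj h).1
      have h4 := (hinj.hasSum_iff (f := fun p : ℕ × ℕ =>
        if p.1 = p.2 then ((2 * Real.pi * ‖c p.1‖ ^ 2 : ℝ) : ℂ) else 0) (fun p hp => by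
          rw [if_neg fun h => hp ⟨p.1, by ext <;> simp [h]⟩])).2 (by simpa only [h2] using h1)
      simpa [Function.comp_def] using h4
    rw [← h3.tsum_eq, ← Complex.ofReal_tsum, tsum_mul_left]
  have hsq : Summable fun n => ‖c n‖ ^ 2 := by
    refine hcc.comp_injective (i := fun n : ℕ => (n, n)) (fun x y h => (Prod.mk.inj h).1) |>.congr
      fun n => ?_
    simp [sq]
  have hre : ∫ θ in Ioc a (a + 2 * Real.pi), ‖F θ‖ ^ 2 = 2 * Real.pi * ∑' n, ‖c n‖ ^ 2 := by
    rw [← intervalIntegral.integral_of_le hpi]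
    apply Complex.ofReal_injective
    rw [← hint, ← intervalIntegral.integral_ofReal]
    refine intervalIntegral.integral_congr fun θ _ => ?_
    simp only [Complex.mul_conj, Complex.normSq_eq_norm_sq]
  have he : ∀ x : ℂ, ‖x‖ₑ ^ 2 = ENNReal.ofReal (‖x‖ ^ 2) := fun x => by
    rw [ENNReal.ofReal_pow (norm_nonneg _), ofReal_norm]
  simp_rw [he]
  rw [← ofReal_integral_eq_lintegral_ofReal, hre, ENNReal.ofReal_mul (by positivity),
    ENNReal.ofReal_tsum_of_nonneg (fun _ => by positivity) hsq]
  · exact (Continuous.integrableOn_Icc (hFc.norm.pow 2)).mono_set Ioc_subset_Icc_self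
  · exact Filter.Eventually.of_forall fun _ => by positivity

lemma lintegral_areaMeasure (u : ℂ → ℝ≥0∞) :
    ∫⁻ z, u z ∂areaMeasure = ENNReal.ofReal Real.pi⁻¹ * ∫⁻ z in ball (0 : ℂ) 1, u z := by
  rw [areaMeasure, lintegral_smul_measure, smul_eq_mul]

/-- The substitution t = r² absorbs the polar Jacobian and turns radial moments into integrals of
t^n. -/
lemma lintegral_Ioo_comp_sq (Φ : ℝ → ℝ≥0∞) :
    ∫⁻ r in Ioo (0 : ℝ) 1, ENNReal.ofReal (2 * r) * Φ (r ^ 2) = ∫⁻ t in Ioo (0 : ℝ) 1, Φ t := by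
  have himg : (fun r : ℝ => r ^ 2) '' Ioo 0 1 = Ioo 0 1 := by
    ext t
    constructor
    · rintro ⟨r, ⟨h0, h1⟩, rfl⟩
      exact ⟨by positivity, by simp only; nlinarith⟩
    · rintro ⟨h0, h1⟩
      exact ⟨√t, ⟨Real.sqrt_pos.2 h0, by rw [Real.sqrt_lt' one_pos]; simpa using h1⟩,
        Real.sq_sqrt h0.le⟩
  have hinj : InjOn (fun r : ℝ => r ^ 2) (Ioo 0 1) := fun x hx y hy hxy =>
    (pow_left_inj₀ hx.1.le hy.1.le two_ne_zero).1 hxy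
  have := lintegral_image_eq_lintegral_abs_deriv_mul (f := fun r : ℝ => r ^ 2)
    (f' := fun r => 2 * r) measurableSet_Ioo
    (fun x _ => by simpa using (hasDerivAt_pow 2 x).hasDerivWithinAt) hinj Φ
  rw [himg] at this
  rw [this]
  refine setLIntegral_congr_fun measurableSet_Ioo fun r hr => ?_
  rw [abs_of_nonneg (by linarith [hr.1])]

/-- **Parseval's identity** on the disc for a radial weight. -/
lemma lintegral_sq_mul_radial {h : ℂ → ℂ} {c : ℕ → ℂ}
    (hc : ∀ z ∈ ball (0 : ℂ) 1, HasSum (fun n => c n * z ^ n) (h z))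
    (hd : ContinuousOn h (ball 0 1)) {w : ℝ → ℝ≥0∞} (hw : Measurable w) :
    ∫⁻ z, ‖h z‖ₑ ^ 2 * w (‖z‖ ^ 2) ∂areaMeasure
      = ∑' n, ‖c n‖ₑ ^ 2 * ∫⁻ t in Ioo (0 : ℝ) 1, ENNReal.ofReal t ^ n * w t := by
  set U : ℂ → ℝ≥0∞ := (ball (0 : ℂ) 1).indicator fun z => ‖h z‖ₑ ^ 2 * w (‖z‖ ^ 2) with hU
  have hUm : Measurable U := by
    have h1 : Measurable ((ball (0 : ℂ) 1).indicator h) := by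
      classical
      rw [← piecewise_eq_indicator]
      exact hd.measurable_piecewise continuousOn_const measurableSet_ball
    -- Nothing is known about `h` off the disc, so it is cut off before measurability is used.
    have h2 : U = (ball (0 : ℂ) 1).indicator fun z =>
        ‖(ball (0 : ℂ) 1).indicator h z‖ₑ ^ 2 * w (‖z‖ ^ 2) := by
      rw [hU]
      refine indicator_congr fun z hz => ?_
      rw [indicator_of_mem hz]
    rw [h2]
    exact ((h1.enorm.pow_const 2).mul (hw.comp (by fun_prop))).indicator measurableSet_ball
  set Φ : ℝ → ℝ≥0∞ := fun t => w t * ∑' n, ‖c n‖ₑ ^ 2 * ENNReal.ofReal t ^ n with hΦ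
  have hpolar : ∀ p : ℝ × ℝ, Complex.polarCoord.symm p = p.1 * circleMap 0 1 p.2 := fun p => by
    rw [Complex.polarCoord_symm_apply, circleMap_zero, Complex.exp_mul_I]
    simp
  -- The angular integral 2πr is split as π · 2r: π cancels the normalization of area, 2r is the
  -- derivative of r².
  have hinner : ∀ r ∈ Ioi (0 : ℝ), ∫⁻ θ in Ioo (-Real.pi) Real.pi,
      ENNReal.ofReal r • U (Complex.polarCoord.symm (r, θ))
      = (Ioo (0 : ℝ) 1).indicator (fun r => ENNReal.ofReal Real.pi *
          (ENNReal.ofReal (2 * r) * Φ (r ^ 2))) r := by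
    intro r hr
    have hr0 : 0 < r := hr
    have hn : ∀ θ : ℝ, ‖(r : ℂ) * circleMap 0 1 θ‖ = r := fun θ => by
      simp [abs_of_pos hr0]
    by_cases hr1 : r < 1
    · have hmem : ∀ θ : ℝ, (r : ℂ) * circleMap 0 1 θ ∈ ball (0 : ℂ) 1 := fun θ => by
        rw [mem_ball_zero_iff, hn]; exact hr1
      have hs : Summable fun n => ‖c n * (r : ℂ) ^ n‖ := by
        have := (hc r (by simpa [abs_of_pos hr0] using hr1)).summable.norm
        exact this
      have hpars := lintegral_arc_tsum_sq (-Real.pi) hs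
      rw [show -Real.pi + 2 * Real.pi = Real.pi by ring] at hpars
      have hval : ∀ θ : ℝ, U (Complex.polarCoord.symm (r, θ))
          = ‖∑' n, c n * (r : ℂ) ^ n * circleMap 0 1 θ ^ n‖ₑ ^ 2 * w (r ^ 2) := fun θ => by
        rw [hpolar, hU, indicator_of_mem (hmem θ), hn, ← (hc _ (hmem θ)).tsum_eq]
        simp_rw [mul_pow, mul_assoc]
      rw [indicator_of_mem (show r ∈ Ioo (0 : ℝ) 1 from ⟨hr0, hr1⟩)]
      simp_rw [hval, smul_eq_mul]
      have hm : Measurable fun θ : ℝ =>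
          ‖∑' n, c n * (r : ℂ) ^ n * circleMap 0 1 θ ^ n‖ₑ ^ 2 :=
        ((continuous_tsum (fun n => by fun_prop) hs
          (fun n θ => by simp)).measurable.enorm.pow_const 2)
      rw [lintegral_const_mul _ (hm.mul_const _), lintegral_mul_const _ hm,
        restrict_Ioo_eq_restrict_Ioc, hpars, hΦ]
      have hterm : ∀ n, ‖c n * (r : ℂ) ^ n‖ₑ ^ 2 = ‖c n‖ₑ ^ 2 * ENNReal.ofReal (r ^ 2) ^ n :=
        fun n => by
          have hre : ‖(r : ℂ)‖ₑ = ENNReal.ofReal r := by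
            rw [← ofReal_norm, Complex.norm_real, Real.norm_of_nonneg hr0.le]
          rw [enorm_mul, mul_pow, enorm_pow, ← pow_mul, mul_comm n 2, pow_mul,
            ENNReal.ofReal_pow hr0.le, hre]
      simp_rw [hterm]
      rw [ENNReal.ofReal_mul two_pos.le, ENNReal.ofReal_mul two_pos.le]
      ring
    · have hval : ∀ θ : ℝ, U (Complex.polarCoord.symm (r, θ)) = 0 := fun θ => by
        rw [hpolar, hU, indicator_of_notMem]
        rw [mem_ball_zero_iff, hn]; exact hr1
      rw [indicator_of_notMem fun h : r ∈ Ioo (0 : ℝ) 1 => hr1 h.2]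
      simp only [hval, smul_zero, lintegral_zero]
  have hpi : ENNReal.ofReal Real.pi⁻¹ * ENNReal.ofReal Real.pi = 1 := by
    rw [← ENNReal.ofReal_mul (by positivity), inv_mul_cancel₀ Real.pi_ne_zero, ENNReal.ofReal_one]
  rw [lintegral_areaMeasure, ← lintegral_indicator measurableSet_ball,
    ← Complex.lintegral_comp_polarCoord_symm, polarCoord_target, Measure.volume_eq_prod,
    ← Measure.prod_restrict, lintegral_prod]
  · rw [setLIntegral_congr_fun measurableSet_Ioi hinner, lintegral_indicator measurableSet_Ioo,
      Measure.restrict_restrict measurableSet_Ioo,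
      inter_eq_self_of_subset_left (Ioo_subset_Ioi_self : Ioo (0 : ℝ) 1 ⊆ Ioi 0),
      lintegral_const_mul' _ _ ENNReal.ofReal_ne_top, ← mul_assoc, hpi, one_mul,
      lintegral_Ioo_comp_sq, hΦ]
    simp_rw [← ENNReal.tsum_mul_left]
    rw [lintegral_tsum fun n => by fun_prop]
    refine tsum_congr fun n => ?_
    rw [← lintegral_const_mul _ (by fun_prop)]
    exact lintegral_congr fun t => by ring
  · refine Measurable.aemeasurable ?_
    have : Measurable fun p : ℝ × ℝ => (p.1 : ℂ) * circleMap 0 1 p.2 := by fun_prop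
    simp_rw [hpolar]
    exact (by fun_prop : Measurable fun p : ℝ × ℝ => ENNReal.ofReal p.1).smul (hUm.comp this)

lemma lintegral_circleMeasure {u : ℂ → ℝ≥0∞} (hu : ContinuousOn u (sphere 0 1)) :
    ∫⁻ ξ, u ξ ∂circleMeasure = ENNReal.ofReal (2 * Real.pi)⁻¹ *
      ∫⁻ θ in Ioc 0 (2 * Real.pi), u (circleMap 0 1 θ) := by
  have hmem : ∀ θ : ℝ, circleMap 0 1 θ ∈ sphere (0 : ℂ) 1 := fun θ => by simp
  have hae : ∀ᵐ ξ ∂((volume.restrict (Ioc (0 : ℝ) (2 * Real.pi))).map (circleMap 0 1)),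
      ξ ∈ sphere (0 : ℂ) 1 := by
    exact (ae_map_iff (p := (· ∈ sphere (0 : ℂ) 1)) (by fun_prop) isClosed_sphere.measurableSet).2
      (Filter.Eventually.of_forall hmem)
  have hm : Measurable ((sphere (0 : ℂ) 1).indicator u) := by
    classical
    rw [← piecewise_eq_indicator]
    exact hu.measurable_piecewise continuousOn_const isClosed_sphere.measurableSet
  rw [circleMeasure, lintegral_smul_measure, smul_eq_mul]
  congr 1
  rw [lintegral_congr_ae (g := (sphere (0 : ℂ) 1).indicator u), lintegral_map hm (by fun_prop)]
  · exact lintegral_congr fun θ => indicator_of_mem (hmem θ) _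
  · filter_upwards [hae] with ξ hξ
    rw [indicator_of_mem hξ]

lemma ae_circleMeasure_mem_sphere : ∀ᵐ ξ ∂circleMeasure, ξ ∈ sphere (0 : ℂ) 1 := by
  refine Measure.ae_smul_measure ?_ _
  exact (ae_map_iff (p := (· ∈ sphere (0 : ℂ) 1)) (by fun_prop) isClosed_sphere.measurableSet).2
    (Filter.Eventually.of_forall fun θ => by simp)

/-- **Parseval's identity** on the unit circle. -/
lemma lintegral_circleMeasure_tsum_sq {c : ℕ → ℂ} (hc : Summable fun n => ‖c n‖) :
    ∫⁻ ξ, ‖∑' n, c n * ξ ^ n‖ₑ ^ 2 ∂circleMeasure = ∑' n, ‖c n‖ₑ ^ 2 := by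
  rw [lintegral_circleMeasure]
  · have := lintegral_arc_tsum_sq 0 hc
    rw [zero_add] at this
    rw [this, ← mul_assoc, ← ENNReal.ofReal_mul (by positivity),
      inv_mul_cancel₀ (by positivity), ENNReal.ofReal_one, one_mul]
  · have h : ContinuousOn (fun ξ : ℂ => ∑' n, c n * ξ ^ n) (sphere 0 1) :=
      continuousOn_tsum (fun n => by fun_prop) hc fun n ξ hξ => by
        rw [norm_mul, norm_pow, mem_sphere_zero_iff_norm.1 hξ, one_pow, mul_one]
    exact (ENNReal.continuous_pow 2).comp_continuousOn h.enorm

/-! ### Taylor coefficients and the Hardy norm. -/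

lemma hasSum_taylor {f : ℂ → ℂ} (hf : DifferentiableOn ℂ f (ball 0 1)) {z : ℂ}
    (hz : z ∈ ball (0 : ℂ) 1) :
    HasSum (fun n => iteratedDeriv n f 0 / (n ! : ℂ) * z ^ n) (f z) := by
  have := Complex.hasSum_taylorSeries_on_ball hf hz
  have he : ∀ n : ℕ, iteratedDeriv n f 0 / (n ! : ℂ) * z ^ n
      = ((n ! : ℂ))⁻¹ • (z - 0) ^ n • iteratedDeriv n f 0 := fun n => by
    rw [sub_zero, smul_eq_mul, smul_eq_mul]
    ring
  simpa only [he] using this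

lemma differentiableOn_iteratedDeriv {f : ℂ → ℂ} (hf : DifferentiableOn ℂ f (ball 0 1)) (k : ℕ) :
    DifferentiableOn ℂ (iteratedDeriv k f) (ball 0 1) := by
  induction k with
  | zero => simpa using hf
  | succ k ih => rw [iteratedDeriv_succ]; exact ih.deriv isOpen_ball

lemma iteratedDeriv_iteratedDeriv (n k : ℕ) (f : ℂ → ℂ) :
    iteratedDeriv n (iteratedDeriv k f) = iteratedDeriv (n + k) f := by
  simp only [iteratedDeriv_eq_iterate, Function.iterate_add_apply]

lemma enorm_div_factorial_sq (x : ℂ) (n : ℕ) :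
    ‖x / (n ! : ℂ)‖ₑ ^ 2 = ‖x‖ₑ ^ 2 * ENNReal.ofReal (1 / (n ! : ℝ) ^ 2) := by
  have h : ‖((n ! : ℂ))⁻¹‖ₑ = ENNReal.ofReal (1 / (n ! : ℝ)) := by
    rw [← ofReal_norm, norm_inv, Complex.norm_natCast, one_div]
  rw [div_eq_mul_inv, enorm_mul, mul_pow, h, ← ENNReal.ofReal_pow (by positivity), one_div_pow]

/-- The Hardy norm in terms of the Taylor coefficients. -/
lemma hardyNormSq_eq_tsum {f : ℂ → ℂ} {c : ℕ → ℂ}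
    (hc : ∀ z ∈ ball (0 : ℂ) 1, HasSum (fun n => c n * z ^ n) (f z)) :
    hardyNormSq f = ∑' n, ‖c n‖ₑ ^ 2 := by
  have hr : ∀ r ∈ Ioo (0 : ℝ) 1, ∫⁻ ξ, ‖f ((r : ℂ) * ξ)‖ₑ ^ 2 ∂circleMeasure
      = ∑' n, ‖c n‖ₑ ^ 2 * ENNReal.ofReal r ^ (2 * n) := by
    intro r hr
    have hre : ‖(r : ℂ)‖ₑ = ENNReal.ofReal r := by
      rw [← ofReal_norm, Complex.norm_real, Real.norm_of_nonneg hr.1.le]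
    have hs : Summable fun n => ‖c n * (r : ℂ) ^ n‖ :=
      (hc r (by simpa [abs_of_pos hr.1] using hr.2)).summable.norm
    have := lintegral_circleMeasure_tsum_sq hs
    rw [lintegral_congr_ae (g := fun ξ => ‖∑' n, c n * (r : ℂ) ^ n * ξ ^ n‖ₑ ^ 2), this]
    · refine tsum_congr fun n => ?_
      rw [enorm_mul, mul_pow, enorm_pow, hre, ← pow_mul, mul_comm n]
    · filter_upwards [ae_circleMeasure_mem_sphere] with ξ hξ
      have hξ' : (r : ℂ) * ξ ∈ ball (0 : ℂ) 1 := by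
        rw [mem_ball_zero_iff, norm_mul, mem_sphere_zero_iff_norm.1 hξ]
        simpa [abs_of_pos hr.1] using hr.2
      rw [← (hc _ hξ').tsum_eq]
      simp_rw [mul_pow, mul_assoc]
  rw [hardyNormSq]
  apply le_antisymm
  · refine iSup₂_le fun r hr' => ?_
    rw [hr r hr']
    refine ENNReal.tsum_le_tsum fun n => mul_le_of_le_one_right' ?_
    exact pow_le_one₀ zero_le (ENNReal.ofReal_le_one.2 hr'.2.le)
  -- Each finite partial sum is the limit, as r → 1 from below, of partial sums of the circle means.
  · rw [ENNReal.tsum_eq_iSup_sum]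
    refine iSup_le fun s => ?_
    have hlim : Filter.Tendsto (fun r : ℝ => ∑ n ∈ s, ‖c n‖ₑ ^ 2 * ENNReal.ofReal r ^ (2 * n))
        (nhdsWithin 1 (Iio 1)) (nhds (∑ n ∈ s, ‖c n‖ₑ ^ 2)) := by
      have : ContinuousAt
          (fun r : ℝ => ∑ n ∈ s, ‖c n‖ₑ ^ 2 * ENNReal.ofReal r ^ (2 * n)) 1 := by
        refine Continuous.continuousAt (continuous_finsetSum _ fun n _ => ?_)
        exact ENNReal.continuous_const_mul (by finiteness) |>.comp
          ((ENNReal.continuous_pow _).comp ENNReal.continuous_ofReal)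
      simpa using this.tendsto.mono_left nhdsWithin_le_nhds
    refine le_of_tendsto hlim ?_
    filter_upwards [Ioo_mem_nhdsLT zero_lt_one] with r hr'
    refine le_trans ?_ (le_iSup₂_of_le r hr' le_rfl)
    rw [hr r hr']
    exact ENNReal.sum_le_tsum s

/-! ### The weight of σ and the integrals D_{σ,k}. -/

lemma circleMeasure_ball : circleMeasure (ball (0 : ℂ) 1) = 0 :=
  measure_mono_null (fun ξ (hξ : ξ ∈ ball 0 1) (h : ξ ∈ sphere (0 : ℂ) 1) =>
    (mem_ball.1 hξ).ne (mem_sphere.1 h)) (mem_ae_iff.1 ae_circleMeasure_mem_sphere)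

/-- For |ξ| = 1 one has |z - ξ| = |1 - conj z · ξ|, so 1/|z - ξ|² is the squared modulus of a
geometric series in ξ, and Parseval gives mean 1/(1 - |z|²). This makes the weight of σ radial. -/
lemma lintegral_inv_norm_sub_sq {z : ℂ} (hz : z ∈ ball (0 : ℂ) 1) (k : ℕ) :
    ∫⁻ ξ in sphere (0 : ℂ) 1, ENNReal.ofReal ((1 - ‖z‖ ^ 2) ^ (k + 1) / ‖z - ξ‖ ^ 2) ∂circleMeasure
      = ENNReal.ofReal ((1 - ‖z‖ ^ 2) ^ k) := by
  have hz1 : ‖z‖ < 1 := mem_ball_zero_iff.1 hz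
  have hz2 : 0 < 1 - ‖z‖ ^ 2 := by nlinarith [norm_nonneg z]
  have hs : Summable fun n : ℕ => ‖conj z ^ n‖ := by
    simpa using summable_geometric_of_lt_one (norm_nonneg z) hz1
  have hpars := lintegral_circleMeasure_tsum_sq hs
  have hgeo : ∑' n : ℕ, ‖conj z ^ n‖ₑ ^ 2 = ENNReal.ofReal (1 - ‖z‖ ^ 2)⁻¹ := by
    have : ∀ n : ℕ, ‖conj z ^ n‖ₑ ^ 2 = ENNReal.ofReal ((‖z‖ ^ 2) ^ n) := fun n => by
      rw [← ofReal_norm, ← ENNReal.ofReal_pow (norm_nonneg _), norm_pow, RCLike.norm_conj,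
        ← pow_mul, ← pow_mul, mul_comm]
    simp_rw [this]
    rw [← ENNReal.ofReal_tsum_of_nonneg (fun n => by positivity)
      (summable_geometric_of_lt_one (by positivity) (by nlinarith [norm_nonneg z])),
      tsum_geometric_of_lt_one (by positivity) (by nlinarith [norm_nonneg z])]
  rw [Measure.restrict_eq_self_of_ae_mem ae_circleMeasure_mem_sphere]
  have hpt : ∀ᵐ ξ ∂circleMeasure, ENNReal.ofReal ((1 - ‖z‖ ^ 2) ^ (k + 1) / ‖z - ξ‖ ^ 2)
      = ENNReal.ofReal ((1 - ‖z‖ ^ 2) ^ (k + 1)) * ‖∑' n, conj z ^ n * ξ ^ n‖ₑ ^ 2 := by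
    filter_upwards [ae_circleMeasure_mem_sphere] with ξ hξ
    have hξ1 : ‖ξ‖ = 1 := mem_sphere_zero_iff_norm.1 hξ
    have h1 : ‖conj z * ξ‖ < 1 := by rw [norm_mul, RCLike.norm_conj, hξ1, mul_one]; exact hz1
    have h2 : ‖1 - conj z * ξ‖ = ‖z - ξ‖ := by
      have : 1 - conj z * ξ = conj (ξ - z) * ξ := by
        rw [map_sub, sub_mul, mul_comm (conj ξ), Complex.mul_conj, Complex.normSq_eq_norm_sq, hξ1]
        simp
      rw [this, norm_mul, RCLike.norm_conj, hξ1, mul_one, norm_sub_rev]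
    simp_rw [← mul_pow]
    rw [tsum_geometric_of_norm_lt_one h1, ← ofReal_norm, norm_inv, h2,
      ← ENNReal.ofReal_pow (by positivity), ← ENNReal.ofReal_mul (by positivity), inv_pow,
      div_eq_mul_inv]
  rw [lintegral_congr_ae hpt, lintegral_const_mul' _ _ ENNReal.ofReal_ne_top, hpars, hgeo,
    ← ENNReal.ofReal_mul (by positivity)]
  congr 1
  field_simp
  ring

lemma weight_circleMeasure {z : ℂ} (hz : z ∈ ball (0 : ℂ) 1) (k : ℕ) :
    weight circleMeasure (k + 1) z
      = ENNReal.ofReal (1 / (((k + 1)! : ℝ) * (k ! : ℝ)) * (1 - ‖z‖ ^ 2) ^ k) := by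
  rw [weight, setLIntegral_measure_zero _ _ circleMeasure_ball, mul_zero, zero_add,
    lintegral_inv_norm_sub_sq hz, ← ENNReal.ofReal_mul (by positivity), Nat.add_sub_cancel]

lemma dirichletIntegral_circleMeasure (k : ℕ) (f : ℂ → ℂ) :
    dirichletIntegral circleMeasure (k + 1) f = ENNReal.ofReal (1 / (((k + 1)! : ℝ) * (k ! : ℝ))) *
      ∫⁻ z, ‖iteratedDeriv (k + 1) f z‖ₑ ^ 2 * ENNReal.ofReal ((1 - ‖z‖ ^ 2) ^ k) ∂areaMeasure := by
  rw [← lintegral_const_mul' _ _ ENNReal.ofReal_ne_top, dirichletIntegral, lintegral_areaMeasure,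
    lintegral_areaMeasure]
  congr 1
  refine setLIntegral_congr_fun measurableSet_ball fun z hz => ?_
  rw [weight_circleMeasure hz, ENNReal.ofReal_mul (by positivity)]
  ring

/-- A Beta integral, by induction on `m` through the splitting (1-t)^(m+1) = (1-t)^m - t(1-t)^m. -/
lemma integral_pow_mul_one_sub_pow (n m : ℕ) :
    ∫ t in (0 : ℝ)..1, t ^ n * (1 - t) ^ m = (n ! * m ! : ℝ) / (n + m + 1)! := by
  induction m generalizing n with
  | zero =>
    simp only [pow_zero, mul_one, integral_pow, one_pow, Nat.factorial_zero, Nat.cast_one,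
      add_zero, Nat.factorial_succ]
    push_cast
    have : (n ! : ℝ) ≠ 0 := by positivity
    field_simp
    simp
  | succ m ih =>
    have h : ∀ t : ℝ, t ^ n * (1 - t) ^ (m + 1) = t ^ n * (1 - t) ^ m - t ^ (n + 1) * (1 - t) ^ m :=
      fun t => by ring
    simp_rw [h]
    rw [intervalIntegral.integral_sub (Continuous.intervalIntegrable (by fun_prop) _ _)
      (Continuous.intervalIntegrable (by fun_prop) _ _), ih, ih,
      show n + (m + 1) + 1 = (n + m + 1) + 1 by ring, show n + 1 + m + 1 = (n + m + 1) + 1 by ring,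
      Nat.factorial_succ (n + m + 1), Nat.factorial_succ n, Nat.factorial_succ m]
    push_cast
    field_simp
    ring

lemma lintegral_Ioo_eq_ofReal {v : ℝ → ℝ} (hi : IntervalIntegrable v volume 0 1)
    (h0 : ∀ t ∈ Ioo (0 : ℝ) 1, 0 ≤ v t) :
    ∫⁻ t in Ioo (0 : ℝ) 1, ENNReal.ofReal (v t) = ENNReal.ofReal (∫ t in (0 : ℝ)..1, v t) := by
  rw [intervalIntegral.integral_of_le zero_le_one, restrict_Ioo_eq_restrict_Ioc]
  refine (ofReal_integral_eq_lintegral_ofReal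
    ((intervalIntegrable_iff_integrableOn_Ioc_of_le zero_le_one).1 hi) ?_).symm
  rw [← restrict_Ioo_eq_restrict_Ioc]
  exact (ae_restrict_iff' measurableSet_Ioo).2 (Filter.Eventually.of_forall h0)

lemma lintegral_pow_mul_ofReal {w : ℝ → ℝ} (hw : IntervalIntegrable w volume 0 1)
    (h0 : ∀ t ∈ Ioo (0 : ℝ) 1, 0 ≤ w t) (n : ℕ) :
    ∫⁻ t in Ioo (0 : ℝ) 1, ENNReal.ofReal t ^ n * ENNReal.ofReal (w t)
      = ENNReal.ofReal (∫ t in (0 : ℝ)..1, t ^ n * w t) := by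
  rw [← lintegral_Ioo_eq_ofReal (hw.continuousOn_mul (by fun_prop))
    fun t ht => mul_nonneg (pow_nonneg ht.1.le n) (h0 t ht)]
  refine setLIntegral_congr_fun measurableSet_Ioo fun t ht => ?_
  rw [ENNReal.ofReal_mul (pow_nonneg ht.1.le n), ENNReal.ofReal_pow ht.1.le]

/-- `D_{σ,k}` in terms of the Taylor coefficients. -/
lemma circleDirichletIntegral_eq_tsum {f : ℂ → ℂ} (hf : DifferentiableOn ℂ f (ball 0 1)) (k : ℕ) :
    circleDirichletIntegral k f = ∑' n, ‖iteratedDeriv (n + k) f 0‖ₑ ^ 2 *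
      ENNReal.ofReal (1 / ((n ! : ℝ) * k ! * (n + k)!)) := by
  cases k with
  | zero =>
    rw [circleDirichletIntegral, if_pos rfl, hardyNormSq_eq_tsum fun z hz => hasSum_taylor hf hz]
    refine tsum_congr fun n => ?_
    rw [enorm_div_factorial_sq]
    simp [sq]
  | succ k =>
    rw [circleDirichletIntegral, if_neg k.succ_ne_zero, dirichletIntegral_circleMeasure,
      lintegral_sq_mul_radial (w := fun t => ENNReal.ofReal ((1 - t) ^ k))
        (fun z hz => hasSum_taylor (differentiableOn_iteratedDeriv hf (k + 1)) hz)
        (differentiableOn_iteratedDeriv hf (k + 1)).continuousOn (by fun_prop),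
      ← ENNReal.tsum_mul_left]
    refine tsum_congr fun n => ?_
    rw [enorm_div_factorial_sq, lintegral_pow_mul_ofReal
      (Continuous.intervalIntegrable (by fun_prop) _ _)
      fun t ht => pow_nonneg (by linarith [ht.2]) k, integral_pow_mul_one_sub_pow,
      iteratedDeriv_iteratedDeriv, mul_assoc, mul_left_comm,
      ← ENNReal.ofReal_mul (by positivity), ← ENNReal.ofReal_mul (by positivity)]
    congr 2
    rw [add_assoc]
    field_simp

/-! ### The Green–Almansi function with pole at the origin, and the case ζ = 0. -/

/-- `(-1)^{k+1} G_k(z, 0)`, for `k = m + 1`, as a function of `|z|²`. -/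
def greenRadial : ℕ → ℝ → ℝ
  | 0, t => -Real.log t
  | m + 1, t => (1 - t) ^ (m + 1) / (m + 1 : ℕ) - t * greenRadial m t

/-- Raising the order by one multiplies all existing terms by |z|² and adds one new summand; the
alternating sign turns this into the recursion of `greenRadial`. -/
lemma greenAlmansi_zero_right (m : ℕ) (z : ℂ) :
    (-1 : ℝ) ^ (m + 1 + 1) * greenAlmansi (m + 1) z 0 = greenRadial m (‖z‖ ^ 2) := by
  induction m with
  | zero => simp [greenAlmansi, greenRadial]
  | succ m ih =>
    have h : greenAlmansi (m + 1 + 1) z 0 = ‖z‖ ^ 2 * greenAlmansi (m + 1) z 0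
        + (-1 : ℝ) ^ (m + 1) / (m + 1 : ℕ) * (1 - ‖z‖ ^ 2) ^ (m + 1) := by
      simp only [greenAlmansi, Nat.add_sub_cancel]
      rw [Finset.sum_Icc_succ_top (by omega), mul_add (‖z‖ ^ 2), Finset.mul_sum, ← add_assoc]
      congr 1
      · congr 1
        · simp only [zero_sub, norm_neg]
          ring
        · refine Finset.sum_congr rfl fun l hl => ?_
          have hlm := (Finset.mem_Icc.1 hl).2
          rw [show 2 * (m + 1 - l) = 2 + 2 * (m - l) by omega, zero_sub, norm_neg]
          ring
      · simp
    have hs : ((-1 : ℝ) ^ (m + 1)) * (-1) ^ (m + 1) = 1 := by rw [← mul_pow]; simp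
    rw [greenRadial, ← ih, h]
    linear_combination ((1 - ‖z‖ ^ 2) ^ (m + 1) / (m + 1 : ℕ)) * hs

lemma greenRadial_nonneg (m : ℕ) {t : ℝ} (ht : t ∈ Ioo (0 : ℝ) 1) : 0 ≤ greenRadial m t := by
  have h1 : ‖((√t : ℝ) : ℂ)‖ = √t := by simp [abs_of_nonneg (Real.sqrt_nonneg t)]
  have h := greenAlmansi_sign (k := m + 1) (by omega) (z := ((√t : ℝ) : ℂ)) (ζ := 0)
    (by rw [h1, Real.sqrt_lt' one_pos]; simpa using ht.2) (by simp)
    (by simpa using (Real.sqrt_pos.2 ht.1).ne')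
  rwa [greenAlmansi_zero_right, h1, Real.sq_sqrt ht.1.le] at h

lemma measurable_greenRadial (m : ℕ) : Measurable (greenRadial m) := by
  induction m with
  | zero => exact Real.measurable_log.neg
  | succ m ih => simp only [greenRadial]; fun_prop

lemma intervalIntegrable_greenRadial (m : ℕ) : IntervalIntegrable (greenRadial m) volume 0 1 := by
  induction m with
  | zero => exact intervalIntegral.intervalIntegrable_log'.neg
  | succ m ih =>
    exact (Continuous.intervalIntegrable (by fun_prop) _ _).sub (ih.continuousOn_mul continuousOn_id)

lemma integral_pow_mul_neg_log (n : ℕ) :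
    ∫ t in (0 : ℝ)..1, t ^ n * -Real.log t = 1 / (n + 1 : ℝ) ^ 2 := by
  have hn : (n + 1 : ℝ) ≠ 0 := by positivity
  have hi : IntervalIntegrable (fun t : ℝ => t ^ n * -Real.log t) volume 0 1 :=
    (intervalIntegrable_greenRadial 0).continuousOn_mul (by fun_prop)
  -- The primitive of -t^n log t, grouped around t log t so that continuity at 0 is visible.
  have hc : Continuous fun t : ℝ => t ^ n * (t * -Real.log t) / (n + 1) + t ^ (n + 1) / (n + 1) ^ 2 := by
    have : Continuous fun t : ℝ => t * -Real.log t := by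
      simp_rw [mul_neg]
      exact Real.continuous_mul_log.neg
    fun_prop
  rw [intervalIntegral.integral_eq_sub_of_hasDerivAt_of_le zero_le_one hc.continuousOn ?_ hi]
  · simp
  · intro t ht
    have ht0 : t ≠ 0 := ht.1.ne'
    have h1 := ((hasDerivAt_pow n t).mul ((hasDerivAt_id t).mul
      (Real.hasDerivAt_log ht0).neg)).div_const (n + 1 : ℝ)
    have h2 := (hasDerivAt_pow (n + 1) t).div_const ((n + 1 : ℝ) ^ 2)
    refine (h1.add h2).congr_deriv ?_
    have hp : (n : ℝ) * t ^ (n - 1) * t = n * t ^ n := by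
      cases n with
      | zero => simp
      | succ n => simp [pow_succ, mul_assoc]
    simp only [id, Nat.add_sub_cancel, Pi.neg_apply, Pi.mul_apply]
    push_cast
    field_simp
    linear_combination (-Real.log t) * hp

lemma integral_pow_mul_greenRadial (m n : ℕ) :
    ∫ t in (0 : ℝ)..1, t ^ n * greenRadial m t
      = (n ! * m ! : ℝ) / ((n + m + 1)! * (n + m + 1 : ℝ)) := by
  induction m generalizing n with
  | zero =>
    simp only [greenRadial, integral_pow_mul_neg_log, add_zero, Nat.factorial_succ,
      Nat.factorial_zero]
    push_cast
    have : (n ! : ℝ) ≠ 0 := by positivity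
    field_simp
    simp
  | succ m ih =>
    have h : ∀ t : ℝ, t ^ n * greenRadial (m + 1) t
        = t ^ n * (1 - t) ^ (m + 1) / (m + 1 : ℕ) - t ^ (n + 1) * greenRadial m t := fun t => by
      rw [greenRadial]; ring
    simp_rw [h]
    rw [intervalIntegral.integral_sub (Continuous.intervalIntegrable (by fun_prop) _ _)
      ((intervalIntegrable_greenRadial m).continuousOn_mul (by fun_prop)), ih,
      intervalIntegral.integral_div, integral_pow_mul_one_sub_pow,
      show n + (m + 1) + 1 = (n + m + 1) + 1 by ring, show n + 1 + m + 1 = (n + m + 1) + 1 by ring,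
      Nat.factorial_succ (n + m + 1), Nat.factorial_succ n, Nat.factorial_succ m]
    push_cast
    have e : (n : ℝ) + 1 + m + 1 = n + (m + 1) + 1 := by ring
    rw [e]
    field_simp
    ring

/-- `D_{0,k}` in terms of the Taylor coefficients. -/
lemma localDirichletIntegral_zero_eq_tsum {f : ℂ → ℂ} (hf : DifferentiableOn ℂ f (ball 0 1))
    (m : ℕ) :
    localDirichletIntegral 0 (m + 1) f = ∑' n, ‖iteratedDeriv (n + m + 1) f 0‖ₑ ^ 2 *
      ENNReal.ofReal (1 / ((n ! : ℝ) * m ! * (n + m + 1)! * (n + m + 1))) := by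
  have h := lintegral_sq_mul_radial
    (w := fun t => ENNReal.ofReal (1 / (m ! : ℝ) ^ 2) * ENNReal.ofReal (greenRadial m t))
    (fun z hz => hasSum_taylor (differentiableOn_iteratedDeriv hf (m + 1)) hz)
    (differentiableOn_iteratedDeriv hf (m + 1)).continuousOn
    (by have := measurable_greenRadial m; fun_prop)
  rw [localDirichletIntegral_eq (by simp)]
  simp only [Nat.add_sub_cancel, greenAlmansi_zero_right, norm_zero, ne_eq, OfNat.ofNat_ne_zero,
    not_false_eq_true, zero_pow, sub_zero, one_pow, div_one]
  rw [h]
  refine tsum_congr fun n => ?_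
  simp_rw [mul_left_comm _ (ENNReal.ofReal (1 / (m ! : ℝ) ^ 2))]
  rw [lintegral_const_mul' _ _ ENNReal.ofReal_ne_top,
    lintegral_pow_mul_ofReal (intervalIntegrable_greenRadial m) fun t => greenRadial_nonneg m,
    integral_pow_mul_greenRadial, enorm_div_factorial_sq, iteratedDeriv_iteratedDeriv, mul_assoc,
    ← ENNReal.ofReal_mul (by positivity), ← ENNReal.ofReal_mul (by positivity)]
  congr 2
  field_simp

/-- Leibniz' rule has only two terms when one factor is affine. It serves for the factor z at the
origin and for the denominator q in Bol's lemma. -/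
lemma iteratedDeriv_succ_id_mul {h : ℂ → ℂ} (hh : DifferentiableOn ℂ h (ball 0 1)) (n : ℕ) {w : ℂ}
    (hw : w ∈ ball (0 : ℂ) 1) (a b : ℂ) :
    iteratedDeriv (n + 1) (fun z => (a + b * z) * h z) w
      = (a + b * w) * iteratedDeriv (n + 1) h w + (n + 1) * b * iteratedDeriv n h w := by
  have hd : ∀ k, ∀ z ∈ ball (0 : ℂ) 1, HasDerivAt (iteratedDeriv k h) (iteratedDeriv (k + 1) h z) z :=
    fun k z hz => by
      rw [iteratedDeriv_succ]
      exact ((differentiableOn_iteratedDeriv hh k).differentiableAt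
        (isOpen_ball.mem_nhds hz)).hasDerivAt
  have hl : ∀ z : ℂ, HasDerivAt (fun z => a + b * z) b z := fun z => by
    simpa using ((hasDerivAt_id z).const_mul b).const_add a
  induction n generalizing w with
  | zero =>
    rw [iteratedDeriv_succ, iteratedDeriv_zero]
    have h0 := hd 0 w hw
    rw [iteratedDeriv_zero] at h0
    rw [((hl w).fun_mul h0).deriv]
    simp
    ring
  | succ n ih =>
    have he : iteratedDeriv (n + 1) (fun z => (a + b * z) * h z) =ᶠ[nhds w]
        fun z => (a + b * z) * iteratedDeriv (n + 1) h z + (n + 1) * b * iteratedDeriv n h z :=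
      Filter.eventuallyEq_of_mem (isOpen_ball.mem_nhds hw) fun z hz => ih hz
    rw [iteratedDeriv_succ, he.deriv_eq,
      (((hl w).fun_mul (hd (n + 1) w hw)).fun_add ((hd n w hw).const_mul ((n + 1) * b))).deriv]
    push_cast
    ring

/-- The case `ζ = 0` of the theorem. -/
lemma localDirichletIntegral_zero {h : ℂ → ℂ} (hh : DifferentiableOn ℂ h (ball 0 1)) (m : ℕ) :
    localDirichletIntegral 0 (m + 1) (fun z => z * h z) = circleDirichletIntegral m h := by
  rw [localDirichletIntegral_zero_eq_tsum (f := fun z => z * h z) (differentiableOn_id.mul hh),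
    circleDirichletIntegral_eq_tsum hh]
  refine tsum_congr fun n => ?_
  have h1 := iteratedDeriv_succ_id_mul hh (n + m) (mem_ball_self one_pos) 0 1
  simp only [zero_add, one_mul, mul_zero, zero_mul, mul_one] at h1
  -- The square of this factor cancels n+m+1 and reduces (n+m+1)! to (n+m)!.
  have h2 : ‖((n + m : ℕ) + 1 : ℂ)‖ₑ = ENNReal.ofReal (n + m + 1 : ℝ) := by
    rw [← ofReal_norm, ← Nat.cast_succ, Complex.norm_natCast]
    push_cast
    rfl
  rw [h1, enorm_mul, mul_pow, h2, mul_comm (_ ^ 2), mul_assoc, ← ENNReal.ofReal_pow (by positivity),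
    ← ENNReal.ofReal_mul (by positivity), Nat.factorial_succ]
  congr 2
  push_cast
  field_simp

/-! ### The disc automorphism and its change of variables. -/

/-- The disc automorphism taking `0` to `ζ`. -/
def mobius (ζ w : ℂ) : ℂ := (w + ζ) / (1 + conj ζ * w)

variable {ζ w : ℂ}

lemma one_sub_norm_sq_pos (hζ : ζ ∈ ball (0 : ℂ) 1) : 0 < 1 - ‖ζ‖ ^ 2 := by
  have := mem_ball_zero_iff.1 hζ
  nlinarith [norm_nonneg ζ]

lemma one_sub_norm_le_norm_denom (hw : w ∈ ball (0 : ℂ) 1) : 1 - ‖ζ‖ ≤ ‖1 + conj ζ * w‖ := by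
  have h1 : ‖conj ζ * w‖ ≤ ‖ζ‖ := by
    rw [norm_mul, RCLike.norm_conj]
    exact mul_le_of_le_one_right (norm_nonneg _) (mem_ball_zero_iff.1 hw).le
  have h2 := norm_sub_le (1 + conj ζ * w) (conj ζ * w)
  rw [add_sub_cancel_right, norm_one] at h2
  linarith

lemma norm_denom_le_two (hζ : ζ ∈ ball (0 : ℂ) 1) (hw : w ∈ ball (0 : ℂ) 1) :
    ‖1 + conj ζ * w‖ ≤ 2 := by
  have h1 : ‖conj ζ * w‖ ≤ 1 := by
    rw [norm_mul, RCLike.norm_conj]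
    exact mul_le_one₀ (mem_ball_zero_iff.1 hζ).le (norm_nonneg _) (mem_ball_zero_iff.1 hw).le
  have h2 := norm_add_le 1 (conj ζ * w)
  rw [norm_one] at h2
  linarith

lemma norm_denom_pos (hζ : ζ ∈ ball (0 : ℂ) 1) (hw : w ∈ ball (0 : ℂ) 1) :
    0 < ‖1 + conj ζ * w‖ :=
  (sub_pos.2 (mem_ball_zero_iff.1 hζ)).trans_le (one_sub_norm_le_norm_denom hw)

lemma denom_ne_zero (hζ : ζ ∈ ball (0 : ℂ) 1) (hw : w ∈ ball (0 : ℂ) 1) : 1 + conj ζ * w ≠ 0 :=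
  norm_pos_iff.1 (norm_denom_pos hζ hw)

lemma ofReal_one_sub_norm_sq (ζ : ℂ) : ((1 - ‖ζ‖ ^ 2 : ℝ) : ℂ) = 1 - conj ζ * ζ := by
  rw [← Complex.normSq_eq_conj_mul_self, Complex.normSq_eq_norm_sq]
  push_cast
  ring

lemma one_sub_norm_mobius_sq (hζ : ζ ∈ ball (0 : ℂ) 1) (hw : w ∈ ball (0 : ℂ) 1) :
    1 - ‖mobius ζ w‖ ^ 2 = (1 - ‖ζ‖ ^ 2) * (1 - ‖w‖ ^ 2) / ‖1 + conj ζ * w‖ ^ 2 := by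
  have := (norm_denom_pos hζ hw).ne'
  rw [mobius, norm_div, div_pow, one_sub_div (pow_ne_zero 2 this)]
  congr 1
  simp only [← Complex.normSq_eq_norm_sq, Complex.normSq_apply]
  simp
  ring

lemma mobius_mem_ball (hζ : ζ ∈ ball (0 : ℂ) 1) (hw : w ∈ ball (0 : ℂ) 1) :
    mobius ζ w ∈ ball (0 : ℂ) 1 := by
  have h : 0 < 1 - ‖mobius ζ w‖ ^ 2 := by
    rw [one_sub_norm_mobius_sq hζ hw]
    have := norm_denom_pos hζ hw
    have := one_sub_norm_sq_pos hζ
    have := one_sub_norm_sq_pos hw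
    positivity
  rw [mem_ball_zero_iff]
  nlinarith [norm_nonneg (mobius ζ w)]

lemma mobius_sub (hζ : ζ ∈ ball (0 : ℂ) 1) (hw : w ∈ ball (0 : ℂ) 1) :
    mobius ζ w - ζ = w * (1 - ‖ζ‖ ^ 2 : ℝ) / (1 + conj ζ * w) := by
  have := denom_ne_zero hζ hw
  rw [ofReal_one_sub_norm_sq, mobius, div_sub' this]
  congr 1
  ring

lemma one_sub_mobius_mul_conj (hζ : ζ ∈ ball (0 : ℂ) 1) (hw : w ∈ ball (0 : ℂ) 1) :
    1 - mobius ζ w * conj ζ = (1 - ‖ζ‖ ^ 2 : ℝ) / (1 + conj ζ * w) := by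
  have := denom_ne_zero hζ hw
  rw [ofReal_one_sub_norm_sq, mobius, div_mul_eq_mul_div, one_sub_div this]
  congr 1
  ring

lemma hasDerivAt_mobius (hζ : ζ ∈ ball (0 : ℂ) 1) (hw : w ∈ ball (0 : ℂ) 1) :
    HasDerivAt (mobius ζ) ((1 - ‖ζ‖ ^ 2 : ℝ) / (1 + conj ζ * w) ^ 2) w := by
  have hq := denom_ne_zero hζ hw
  have h1 : HasDerivAt (fun w => 1 + conj ζ * w) (conj ζ) w := by
    simpa using ((hasDerivAt_id w).const_mul (conj ζ)).const_add 1
  refine (((hasDerivAt_id w).add_const ζ).div h1 hq).congr_deriv ?_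
  rw [ofReal_one_sub_norm_sq]
  simp only [id]
  ring

lemma neg_mem_ball (hζ : ζ ∈ ball (0 : ℂ) 1) : -ζ ∈ ball (0 : ℂ) 1 := by simpa using hζ

lemma mobius_neg_mobius (hζ : ζ ∈ ball (0 : ℂ) 1) (hw : w ∈ ball (0 : ℂ) 1) :
    mobius (-ζ) (mobius ζ w) = w := by
  have hq := denom_ne_zero hζ hw
  have hc : ((1 - ‖ζ‖ ^ 2 : ℝ) : ℂ) ≠ 0 := by
    exact_mod_cast (one_sub_norm_sq_pos hζ).ne'
  have h1 := mobius_sub hζ hw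
  have h2 := one_sub_mobius_mul_conj hζ hw
  rw [mobius, ← sub_eq_add_neg, h1, map_neg, neg_mul, ← sub_eq_add_neg, mul_comm (conj ζ) (mobius ζ w), h2,
    div_div_div_cancel_right₀ hq, mul_div_cancel_right₀ _ hc]

lemma image_mobius_ball (hζ : ζ ∈ ball (0 : ℂ) 1) : mobius ζ '' ball 0 1 = ball 0 1 := by
  apply Subset.antisymm
  · rintro _ ⟨w, hw, rfl⟩
    exact mobius_mem_ball hζ hw
  · intro z hz
    refine ⟨mobius (-ζ) z, mobius_mem_ball (neg_mem_ball hζ) hz, ?_⟩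
    simpa using mobius_neg_mobius (neg_mem_ball hζ) hz

lemma differentiableOn_comp_mobius (hζ : ζ ∈ ball (0 : ℂ) 1) {f : ℂ → ℂ}
    (hf : DifferentiableOn ℂ f (ball 0 1)) :
    DifferentiableOn ℂ (fun w => f (mobius ζ w)) (ball 0 1) :=
  hf.comp (fun _ hw => (hasDerivAt_mobius hζ hw).differentiableAt.differentiableWithinAt)
    fun _ hw => mobius_mem_ball hζ hw

/-- The determinant of multiplication by `a` is the algebra norm of ℂ over ℝ; it supplies the
Jacobian |φ'|². -/
lemma det_smul_one (a : ℂ) : (a • (1 : ℂ →L[ℝ] ℂ)).det = ‖a‖ ^ 2 := by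
  have h : ((a • (1 : ℂ →L[ℝ] ℂ) : ℂ →L[ℝ] ℂ) : ℂ →ₗ[ℝ] ℂ) = LinearMap.mul ℝ ℂ a := by
    ext
    simp
  have h' : LinearMap.mul ℝ ℂ a = Algebra.lmul ℝ ℂ a := rfl
  rw [ContinuousLinearMap.det, h, h', ← Algebra.norm_apply, Algebra.norm_complex_apply,
    Complex.normSq_eq_norm_sq]

lemma lintegral_areaMeasure_congr {u v : ℂ → ℝ≥0∞} (h : ∀ z ∈ ball (0 : ℂ) 1, u z = v z) :
    ∫⁻ z, u z ∂areaMeasure = ∫⁻ z, v z ∂areaMeasure := by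
  rw [lintegral_areaMeasure, lintegral_areaMeasure,
    setLIntegral_congr_fun measurableSet_ball fun z hz => h z hz]

lemma lintegral_comp_mobius (hζ : ζ ∈ ball (0 : ℂ) 1) (u : ℂ → ℝ≥0∞) :
    ∫⁻ z, u z ∂areaMeasure = ∫⁻ w, ENNReal.ofReal
      ((1 - ‖ζ‖ ^ 2) ^ 2 / ‖1 + conj ζ * w‖ ^ 4) * u (mobius ζ w) ∂areaMeasure := by
  rw [lintegral_areaMeasure, lintegral_areaMeasure]
  congr 1
  have hinj : InjOn (mobius ζ) (ball 0 1) := fun x hx y hy hxy => by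
    rw [← mobius_neg_mobius hζ hx, hxy, mobius_neg_mobius hζ hy]
  have h := lintegral_image_eq_lintegral_abs_det_fderiv_mul volume measurableSet_ball
    (fun w hw => (hasDerivAt_mobius hζ hw).complexToReal_fderiv.hasFDerivWithinAt) hinj u
  rw [image_mobius_ball hζ] at h
  rw [h]
  refine setLIntegral_congr_fun measurableSet_ball fun w hw => ?_
  have : |(1 - ‖ζ‖ ^ 2 : ℝ)| = 1 - ‖ζ‖ ^ 2 := abs_of_pos (one_sub_norm_sq_pos hζ)
  rw [det_smul_one, abs_of_nonneg (by positivity), norm_div, Complex.norm_real, Real.norm_eq_abs,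
    this, norm_pow, div_pow, ← pow_mul]

/-! ### Conformal covariance of the derivatives, the Green–Almansi function and the integrals. -/

/-- **Bol's lemma** for a disc automorphism. -/
lemma iteratedDeriv_comp_mobius (hζ : ζ ∈ ball (0 : ℂ) 1) {f : ℂ → ℂ}
    (hf : DifferentiableOn ℂ f (ball 0 1)) (m : ℕ) (hw : w ∈ ball (0 : ℂ) 1) :
    iteratedDeriv (m + 1) (fun w => (1 + conj ζ * w) ^ m * f (mobius ζ w)) w
      = iteratedDeriv (m + 1) f (mobius ζ w) * ((1 - ‖ζ‖ ^ 2 : ℝ) ^ (m + 1)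
        / (1 + conj ζ * w) ^ (m + 2)) := by
  have hcomp : ∀ k, ∀ z ∈ ball (0 : ℂ) 1, HasDerivAt (fun w => iteratedDeriv k f (mobius ζ w))
      (iteratedDeriv (k + 1) f (mobius ζ z) * ((1 - ‖ζ‖ ^ 2 : ℝ) / (1 + conj ζ * z) ^ 2)) z := by
    intro k z hz
    rw [iteratedDeriv_succ]
    exact ((differentiableOn_iteratedDeriv hf k).differentiableAt
      (isOpen_ball.mem_nhds (mobius_mem_ball hζ hz))).hasDerivAt.comp z (hasDerivAt_mobius hζ hz)
  have hq : ∀ z : ℂ, HasDerivAt (fun w => 1 + conj ζ * w) (conj ζ) z := fun z => by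
    simpa using ((hasDerivAt_id z).const_mul (conj ζ)).const_add 1
  induction m generalizing w with
  | zero =>
    have := hcomp 0 w hw
    simp only [iteratedDeriv_zero] at this
    simpa [iteratedDeriv_succ] using this.deriv
  | succ m ih =>
    have hd : DifferentiableOn ℂ (fun w => (1 + conj ζ * w) ^ m * f (mobius ζ w)) (ball 0 1) :=
      DifferentiableOn.fun_mul (by fun_prop) (differentiableOn_comp_mobius hζ hf)
    have he : iteratedDeriv (m + 1) (fun w => (1 + conj ζ * w) ^ m * f (mobius ζ w)) =ᶠ[nhds w]
        fun w => iteratedDeriv (m + 1) f (mobius ζ w) * ((1 - ‖ζ‖ ^ 2 : ℝ) ^ (m + 1)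
          / (1 + conj ζ * w) ^ (m + 2)) :=
      Filter.eventuallyEq_of_mem (isOpen_ball.mem_nhds hw) fun z hz => ih hz
    have hq0 := denom_ne_zero hζ hw
    have h1 : HasDerivAt (fun w => ((1 - ‖ζ‖ ^ 2 : ℝ) : ℂ) ^ (m + 1) / (1 + conj ζ * w) ^ (m + 2))
        (-((m + 2) * conj ζ * ((1 - ‖ζ‖ ^ 2 : ℝ) : ℂ) ^ (m + 1) / (1 + conj ζ * w) ^ (m + 3))) w := by
      refine ((hasDerivAt_const w (((1 - ‖ζ‖ ^ 2 : ℝ) : ℂ) ^ (m + 1))).fun_div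
        ((hq w).fun_pow (m + 2)) (pow_ne_zero _ hq0)).congr_deriv ?_
      rw [show m + 2 - 1 = m + 1 by omega]
      push_cast
      field_simp
      ring
    -- One factor q is split off. Its Leibniz term (m+2) · conj ζ · (inductive expression) cancels
    -- what comes from differentiating q^{-(m+2)}, so only the next derivative of `f` survives.
    have h2 : (fun w => (1 + conj ζ * w) ^ (m + 1) * f (mobius ζ w))
        = fun w => (1 + conj ζ * w) * ((1 + conj ζ * w) ^ m * f (mobius ζ w)) := by
      ext w; ring
    rw [h2, iteratedDeriv_succ_id_mul hd (m + 1) hw, ih hw, iteratedDeriv_succ (n := m + 1),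
      he.deriv_eq, ((hcomp (m + 1) w hw).fun_mul h1).deriv]
    push_cast
    field_simp
    ring

/-- The logarithm depends only on the pseudohyperbolic distance, which is invariant. The rest is
homogeneous of degree `m` in |ζ - z|² and (1 - |ζ|²)(1 - |z|²), and both pick up the same factor
c²/|q|². -/
lemma greenAlmansi_mobius (hζ : ζ ∈ ball (0 : ℂ) 1) (hw : w ∈ ball (0 : ℂ) 1) (m : ℕ) :
    greenAlmansi (m + 1) (mobius ζ w) ζ
      = ((1 - ‖ζ‖ ^ 2) ^ 2 / ‖1 + conj ζ * w‖ ^ 2) ^ m * greenAlmansi (m + 1) w 0 := by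
  have hq := denom_ne_zero hζ hw
  have hq' := (norm_denom_pos hζ hw).ne'
  have hc := one_sub_norm_sq_pos hζ
  have hcc : ((1 - ‖ζ‖ ^ 2 : ℝ) : ℂ) ≠ 0 := by exact_mod_cast hc.ne'
  have h1 : ζ - mobius ζ w = -(w * (1 - ‖ζ‖ ^ 2 : ℝ) / (1 + conj ζ * w)) := by
    rw [← mobius_sub hζ hw, neg_sub]
  have h2 : ‖ζ - mobius ζ w‖ ^ 2 = ((1 - ‖ζ‖ ^ 2) ^ 2 / ‖1 + conj ζ * w‖ ^ 2) * ‖w‖ ^ 2 := by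
    rw [h1, norm_neg, norm_div, norm_mul, Complex.norm_real, Real.norm_of_nonneg hc.le]
    ring
  have h3 : (1 - mobius ζ w * conj ζ) / (ζ - mobius ζ w) = (1 - w * conj 0) / (0 - w) := by
    rw [one_sub_mobius_mul_conj hζ hw, h1, map_zero, mul_zero, sub_zero, zero_sub]
    -- At the pole both quotients are divisions by zero, with value 0.
    by_cases hw0 : w = 0
    · simp [hw0]
    · field_simp
  simp only [greenAlmansi, Nat.add_sub_cancel, h3, pow_mul, h2, one_sub_norm_mobius_sq hζ hw]
  rw [mul_add, Finset.mul_sum]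
  congr 1
  · rw [zero_sub, norm_neg, mul_pow]
    ring
  · refine Finset.sum_congr rfl fun l hl => ?_
    obtain ⟨j, rfl⟩ := Nat.exists_eq_add_of_le (Finset.mem_Icc.1 hl).2
    rw [Nat.add_sub_cancel_left, zero_sub, norm_neg, norm_zero, pow_add]
    simp only [mul_pow, div_pow]
    generalize 1 - ‖ζ‖ ^ 2 = c
    field_simp
    ring

lemma enorm_sq_eq_ofReal (x : ℂ) : ‖x‖ₑ ^ 2 = ENNReal.ofReal (‖x‖ ^ 2) := by
  rw [ENNReal.ofReal_pow (norm_nonneg _), ofReal_norm]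

/-- Bol's factor squared is c^(2m+2)/|q|^(2m+4), which is the Jacobian c²/|q|⁴ times the Green
factor (c²/|q|²)^m. Only the normalization c^(m+1) is left. -/
lemma localDirichletIntegral_mobius (hζ : ζ ∈ ball (0 : ℂ) 1) {f : ℂ → ℂ}
    (hf : DifferentiableOn ℂ f (ball 0 1)) (m : ℕ) :
    localDirichletIntegral ζ (m + 1) f = ENNReal.ofReal ((1 - ‖ζ‖ ^ 2) ^ (m + 1))⁻¹ *
      localDirichletIntegral 0 (m + 1) (fun w => (1 + conj ζ * w) ^ m * f (mobius ζ w)) := by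
  have hc := one_sub_norm_sq_pos hζ
  rw [localDirichletIntegral_eq (mem_ball_zero_iff.1 hζ), localDirichletIntegral_eq (by simp),
    ← lintegral_const_mul' _ _ ENNReal.ofReal_ne_top, lintegral_comp_mobius hζ]
  refine lintegral_areaMeasure_congr fun w hw => ?_
  have hq := norm_denom_pos hζ hw
  rw [iteratedDeriv_comp_mobius hζ hf m hw, greenAlmansi_mobius hζ hw, enorm_sq_eq_ofReal,
    enorm_sq_eq_ofReal, norm_mul, norm_div, norm_pow, norm_pow, Complex.norm_real,
    Real.norm_of_nonneg hc.le]
  simp only [← mul_assoc]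
  rw [← ENNReal.ofReal_mul (by positivity), ← ENNReal.ofReal_mul (by positivity),
    ← ENNReal.ofReal_mul (by positivity), ← ENNReal.ofReal_mul (by positivity),
    ← ENNReal.ofReal_mul (by positivity), ← ENNReal.ofReal_mul (by positivity)]
  congr 1
  rw [norm_zero]
  generalize 1 - ‖ζ‖ ^ 2 = c at *
  simp only [mul_pow, div_pow]
  field_simp
  ring

/-- As for the local integral, but (1 - |z|²)^m contributes only c^m/|q|^(2m), so a factor c^m
remains. -/
lemma circleDirichletIntegral_mobius (hζ : ζ ∈ ball (0 : ℂ) 1) {g : ℂ → ℂ}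
    (hg : DifferentiableOn ℂ g (ball 0 1)) (m : ℕ) :
    circleDirichletIntegral (m + 1) (fun w => (1 + conj ζ * w) ^ m * g (mobius ζ w))
      = ENNReal.ofReal ((1 - ‖ζ‖ ^ 2) ^ m) * circleDirichletIntegral (m + 1) g := by
  have hc := one_sub_norm_sq_pos hζ
  rw [circleDirichletIntegral, circleDirichletIntegral, if_neg m.succ_ne_zero,
    if_neg m.succ_ne_zero, dirichletIntegral_circleMeasure, dirichletIntegral_circleMeasure,
    mul_left_comm]
  congr 1
  rw [lintegral_comp_mobius hζ (fun z => ‖iteratedDeriv (m + 1) g z‖ₑ ^ 2 * _),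
    ← lintegral_const_mul' _ _ ENNReal.ofReal_ne_top]
  refine lintegral_areaMeasure_congr fun w hw => ?_
  have hq := norm_denom_pos hζ hw
  have hw1 := one_sub_norm_sq_pos hw
  rw [iteratedDeriv_comp_mobius hζ hg m hw, one_sub_norm_mobius_sq hζ hw, enorm_sq_eq_ofReal,
    enorm_sq_eq_ofReal, norm_mul, norm_div, norm_pow, norm_pow, Complex.norm_real,
    Real.norm_of_nonneg hc.le]
  simp only [← mul_assoc]
  rw [← ENNReal.ofReal_mul (by positivity), ← ENNReal.ofReal_mul (by positivity),
    ← ENNReal.ofReal_mul (by positivity), ← ENNReal.ofReal_mul (by positivity)]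
  congr 1
  generalize 1 - ‖ζ‖ ^ 2 = c at *
  generalize 1 - ‖w‖ ^ 2 = d at *
  simp only [mul_pow, div_pow]
  field_simp
  ring

lemma circleDirichletIntegral_const_mul {h : ℂ → ℂ} (hh : DifferentiableOn ℂ h (ball 0 1))
    (m : ℕ) (a : ℂ) :
    circleDirichletIntegral m (fun z => a * h z) = ‖a‖ₑ ^ 2 * circleDirichletIntegral m h := by
  rw [circleDirichletIntegral_eq_tsum (hh.const_mul a), circleDirichletIntegral_eq_tsum hh,
    ← ENNReal.tsum_mul_left]
  refine tsum_congr fun n => ?_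
  rw [iteratedDeriv_const_mul_field, enorm_mul, mul_pow, mul_assoc]

/-! ### The Hardy norm as a limit of Bergman norms, and its conformal covariance. -/

lemma intervalIntegrable_one_sub_rpow {r : ℝ} (hr : -1 < r) :
    IntervalIntegrable (fun t : ℝ => (1 - t) ^ r) volume 0 1 := by
  simpa using ((intervalIntegral.intervalIntegrable_rpow' hr (a := 0) (b := 1)).comp_sub_left 1).symm

lemma integral_one_sub_rpow {r : ℝ} (hr : -1 < r) :
    ∫ t in (0 : ℝ)..1, (1 - t) ^ r = 1 / (r + 1) := by
  rw [intervalIntegral.integral_comp_sub_left (fun t => t ^ r) 1, sub_self, sub_zero,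
    integral_rpow (Or.inl hr), Real.one_rpow, Real.zero_rpow (by linarith), sub_zero]

lemma mul_integral_pow_mul_rpow_le_one (n : ℕ) {s : ℝ} (hs : 0 < s) :
    s * ∫ t in (0 : ℝ)..1, t ^ n * (1 - t) ^ (s - 1) ≤ 1 := by
  have hi := intervalIntegrable_one_sub_rpow (r := s - 1) (by linarith)
  have h2 : ∫ t in (0 : ℝ)..1, t ^ n * (1 - t) ^ (s - 1)
      ≤ ∫ t in (0 : ℝ)..1, (1 - t) ^ (s - 1) := by
    refine intervalIntegral.integral_mono_on_of_le_Ioo zero_le_one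
      (hi.continuousOn_mul (by fun_prop)) hi fun t ht => ?_
    exact mul_le_of_le_one_left (Real.rpow_nonneg (by linarith [ht.2]) _)
      (pow_le_one₀ ht.1.le ht.2.le)
  rw [integral_one_sub_rpow (by linarith), sub_add_cancel] at h2
  have := mul_le_mul_of_nonneg_left h2 hs.le
  rwa [mul_one_div_cancel hs.ne'] at this

/-- As s → 0 the measures s(1-t)^(s-1) dt concentrate at t = 1, so every moment tends to 1. -/
lemma tendsto_mul_integral_pow_mul_rpow (n : ℕ) :
    Filter.Tendsto (fun s : ℝ => s * ∫ t in (0 : ℝ)..1, t ^ n * (1 - t) ^ (s - 1))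
      (nhdsWithin 0 (Ioi 0)) (nhds 1) := by
  have hlim : Filter.Tendsto (fun s : ℝ => 1 - n * s / (s + 1)) (nhdsWithin 0 (Ioi 0)) (nhds 1) := by
    have : ContinuousAt (fun s : ℝ => 1 - n * s / (s + 1)) 0 := by
      fun_prop (disch := norm_num)
    simpa using this.tendsto.mono_left nhdsWithin_le_nhds
  refine tendsto_of_tendsto_of_tendsto_of_le_of_le' hlim tendsto_const_nhds ?_ ?_
  · filter_upwards [self_mem_nhdsWithin] with s (hs : 0 < s)
    have hi := intervalIntegrable_one_sub_rpow (r := s - 1) (by linarith)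
    have hi' := intervalIntegrable_one_sub_rpow (r := s) (by linarith)
    have h1 : ∫ t in (0 : ℝ)..1, ((1 - t) ^ (s - 1) - n * (1 - t) ^ s) = 1 / s - n * (1 / (s + 1)) := by
      rw [intervalIntegral.integral_sub hi (hi'.const_mul _), intervalIntegral.integral_const_mul,
        integral_one_sub_rpow (by linarith), integral_one_sub_rpow (by linarith), sub_add_cancel]
    have h2 : ∫ t in (0 : ℝ)..1, ((1 - t) ^ (s - 1) - n * (1 - t) ^ s)
        ≤ ∫ t in (0 : ℝ)..1, t ^ n * (1 - t) ^ (s - 1) := by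
      refine intervalIntegral.integral_mono_on_of_le_Ioo zero_le_one (hi.sub (hi'.const_mul _))
        (hi.continuousOn_mul (by fun_prop)) fun t ht => ?_
      have ht1 : 0 < 1 - t := by linarith [ht.2]
      -- Bernoulli: t^n ≥ 1 - n(1-t), which reduces the lower bound to explicit power integrals.
      have hb := one_add_mul_le_pow (a := t - 1) (by linarith [ht.1]) n
      rw [add_sub_cancel] at hb
      have hp : (1 - t) ^ s = (1 - t) ^ (s - 1) * (1 - t) := by
        rw [Real.rpow_sub_one ht1.ne', div_mul_cancel₀ _ ht1.ne']
      rw [hp]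
      have := mul_le_mul_of_nonneg_right hb (Real.rpow_nonneg ht1.le (s - 1))
      linarith
    have h3 := mul_le_mul_of_nonneg_left (h1 ▸ h2) hs.le
    refine le_trans (le_of_eq ?_) h3
    field_simp
  · filter_upwards [self_mem_nhdsWithin] with s hs
    exact mul_integral_pow_mul_rpow_le_one n hs

/-- The Hardy norm as a limit of weighted Bergman norms. -/
lemma tendsto_bergman {h : ℂ → ℂ} (hh : DifferentiableOn ℂ h (ball 0 1)) :
    Filter.Tendsto (fun s : ℝ => ENNReal.ofReal s *
        ∫⁻ z, ‖h z‖ₑ ^ 2 * ENNReal.ofReal ((1 - ‖z‖ ^ 2) ^ (s - 1)) ∂areaMeasure)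
      (nhdsWithin 0 (Ioi 0)) (nhds (hardyNormSq h)) := by
  set c : ℕ → ℂ := fun n => iteratedDeriv n h 0 / (n ! : ℂ)
  set b : ℝ → ℕ → ℝ := fun s n => s * ∫ t in (0 : ℝ)..1, t ^ n * (1 - t) ^ (s - 1)
  have hc : ∀ z ∈ ball (0 : ℂ) 1, HasSum (fun n => c n * z ^ n) (h z) := fun z => hasSum_taylor hh
  have hval : ∀ s : ℝ, 0 < s → ENNReal.ofReal s *
      ∫⁻ z, ‖h z‖ₑ ^ 2 * ENNReal.ofReal ((1 - ‖z‖ ^ 2) ^ (s - 1)) ∂areaMeasure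
      = ∑' n, ‖c n‖ₑ ^ 2 * ENNReal.ofReal (b s n) := by
    intro s hs
    rw [lintegral_sq_mul_radial (w := fun t => ENNReal.ofReal ((1 - t) ^ (s - 1))) hc
      hh.continuousOn (by fun_prop), ← ENNReal.tsum_mul_left]
    refine tsum_congr fun n => ?_
    rw [lintegral_pow_mul_ofReal (intervalIntegrable_one_sub_rpow (by linarith))
      fun t ht => Real.rpow_nonneg (by linarith [ht.2]) _, mul_left_comm,
      ← ENNReal.ofReal_mul hs.le]
  rw [hardyNormSq_eq_tsum hc, tendsto_order]
  -- Below, finite partial sums converge; above, every moment is at most 1, so the sum never exceeds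
  -- its limit. No summability is needed.
  constructor
  · intro a ha
    rw [ENNReal.tsum_eq_iSup_sum, lt_iSup_iff] at ha
    obtain ⟨F, hF⟩ := ha
    have hlim : Filter.Tendsto (fun s : ℝ => ∑ n ∈ F, ‖c n‖ₑ ^ 2 * ENNReal.ofReal (b s n))
        (nhdsWithin 0 (Ioi 0)) (nhds (∑ n ∈ F, ‖c n‖ₑ ^ 2)) := by
      refine tendsto_finsetSum _ fun n _ => ?_
      have := ENNReal.tendsto_ofReal (tendsto_mul_integral_pow_mul_rpow n)
      simpa using ENNReal.Tendsto.const_mul (a := ‖c n‖ₑ ^ 2) this (Or.inr (by finiteness))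
    filter_upwards [hlim.eventually (lt_mem_nhds hF), self_mem_nhdsWithin] with s hs hs0
    rw [hval s hs0]
    exact hs.trans_le (ENNReal.sum_le_tsum F)
  · intro a ha
    filter_upwards [self_mem_nhdsWithin] with s hs0
    rw [hval s hs0]
    refine lt_of_le_of_lt (ENNReal.tsum_le_tsum fun n => mul_le_of_le_one_right' ?_) ha
    exact ENNReal.ofReal_le_one.2 (mul_integral_pow_mul_rpow_le_one n hs0)

lemma tendsto_ofReal_mul_rpow (c : ℝ) {a : ℝ} (ha : 0 < a) :
    Filter.Tendsto (fun s : ℝ => ENNReal.ofReal (c * a ^ s)) (nhdsWithin 0 (Ioi 0))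
      (nhds (ENNReal.ofReal c)) := by
  have : ContinuousAt (fun s : ℝ => c * a ^ s) 0 :=
    (Real.continuousAt_const_rpow ha.ne').const_mul c
  simpa using ENNReal.tendsto_ofReal (this.tendsto.mono_left nhdsWithin_le_nhds)

/-- Changing variables in the Bergman norm of exponent s - 1 produces the density c(c/|q|²)^s. As
|q| is bounded above and away from 0 on the disc, this tends to c uniformly, and a squeeze passes to
the limit even when the norms are infinite. -/
lemma hardyNormSq_mobius (hζ : ζ ∈ ball (0 : ℂ) 1) {g : ℂ → ℂ}
    (hg : DifferentiableOn ℂ g (ball 0 1)) :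
    hardyNormSq g = ENNReal.ofReal (1 - ‖ζ‖ ^ 2) *
      hardyNormSq (fun w => (1 + conj ζ * w)⁻¹ * g (mobius ζ w)) := by
  have hc := one_sub_norm_sq_pos hζ
  have hζ1 : 0 < 1 - ‖ζ‖ := sub_pos.2 (mem_ball_zero_iff.1 hζ)
  set H : ℂ → ℂ := fun w => (1 + conj ζ * w)⁻¹ * g (mobius ζ w) with hH
  have hd : DifferentiableOn ℂ H (ball 0 1) :=
    DifferentiableOn.fun_mul (DifferentiableOn.fun_inv (by fun_prop) fun w hw => denom_ne_zero hζ hw)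
      (differentiableOn_comp_mobius hζ hg)
  set c := 1 - ‖ζ‖ ^ 2 with hcdef
  set A : ℝ → ℝ≥0∞ := fun s => ENNReal.ofReal s *
    ∫⁻ z, ‖H z‖ₑ ^ 2 * ENNReal.ofReal ((1 - ‖z‖ ^ 2) ^ (s - 1)) ∂areaMeasure with hA
  have hkey : ∀ s : ℝ, ENNReal.ofReal s *
      ∫⁻ z, ‖g z‖ₑ ^ 2 * ENNReal.ofReal ((1 - ‖z‖ ^ 2) ^ (s - 1)) ∂areaMeasure
      = ENNReal.ofReal s * ∫⁻ w, ENNReal.ofReal (c * (c / ‖1 + conj ζ * w‖ ^ 2) ^ s) *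
        (‖H w‖ₑ ^ 2 * ENNReal.ofReal ((1 - ‖w‖ ^ 2) ^ (s - 1))) ∂areaMeasure := by
    intro s
    rw [lintegral_comp_mobius hζ]
    congr 1
    refine lintegral_areaMeasure_congr fun w hw => ?_
    have hq := norm_denom_pos hζ hw
    have hw1 := one_sub_norm_sq_pos hw
    rw [one_sub_norm_mobius_sq hζ hw, hH, enorm_sq_eq_ofReal, enorm_sq_eq_ofReal, norm_mul,
      norm_inv, ← hcdef, mul_div_right_comm, Real.mul_rpow (by positivity) hw1.le,
      Real.rpow_sub_one (x := c / _) (by positivity)]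
    simp only [← mul_assoc]
    rw [← ENNReal.ofReal_mul (by positivity), ← ENNReal.ofReal_mul (by positivity),
      ← ENNReal.ofReal_mul (by positivity), ← ENNReal.ofReal_mul (by positivity)]
    congr 1
    generalize (c / ‖1 + conj ζ * w‖ ^ 2) ^ s = x
    field_simp
  have hbound : ∀ w ∈ ball (0 : ℂ) 1, c / 4 ≤ c / ‖1 + conj ζ * w‖ ^ 2 ∧
      c / ‖1 + conj ζ * w‖ ^ 2 ≤ c / (1 - ‖ζ‖) ^ 2 := by
    intro w hw
    have hq := norm_denom_pos hζ hw
    have h2 := norm_denom_le_two hζ hw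
    have h1 := one_sub_norm_le_norm_denom (ζ := ζ) hw
    constructor
    · gcongr
      nlinarith
    · gcongr
  have hlimA := tendsto_bergman hd
  have hlimg := tendsto_bergman hg
  have hmul : ∀ a : ℝ, 0 < a → Filter.Tendsto (fun s : ℝ => ENNReal.ofReal (c * a ^ s) * A s)
      (nhdsWithin 0 (Ioi 0)) (nhds (ENNReal.ofReal c * hardyNormSq H)) := fun a ha =>
    ENNReal.Tendsto.mul (tendsto_ofReal_mul_rpow c ha) (Or.inl (by simpa using hc)) hlimA
      (Or.inr ENNReal.ofReal_ne_top)
  have hpull : ∀ a s : ℝ, ENNReal.ofReal (c * a ^ s) * A s = ENNReal.ofReal s *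
      ∫⁻ w, ENNReal.ofReal (c * a ^ s) *
        (‖H w‖ₑ ^ 2 * ENNReal.ofReal ((1 - ‖w‖ ^ 2) ^ (s - 1))) ∂areaMeasure := fun a s => by
    rw [lintegral_const_mul' _ _ ENNReal.ofReal_ne_top, hA, mul_left_comm]
  refine tendsto_nhds_unique hlimg ?_
  refine tendsto_of_tendsto_of_tendsto_of_le_of_le' (hmul (c / 4) (by positivity))
    (hmul (c / (1 - ‖ζ‖) ^ 2) (by positivity)) ?_ ?_
  all_goals
    filter_upwards [self_mem_nhdsWithin] with s (hs : 0 < s)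
    rw [hpull, hkey, lintegral_areaMeasure, lintegral_areaMeasure]
    refine mul_le_mul_right (mul_le_mul_right
      (setLIntegral_mono' measurableSet_ball fun w hw => mul_le_mul_left
        (ENNReal.ofReal_le_ofReal (mul_le_mul_of_nonneg_left ?_ hc.le)) _) _) _
    have hq := norm_denom_pos hζ hw
    first
    | exact Real.rpow_le_rpow (by positivity) (hbound w hw).1 hs.le
    | exact Real.rpow_le_rpow (by positivity) (hbound w hw).2 hs.le

/-! ### Transport to the origin and conclusion. -/

lemma localDirichletIntegral_congr (hζ : ζ ∈ ball (0 : ℂ) 1) (k : ℕ) {f g : ℂ → ℂ}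
    (h : EqOn f g (ball 0 1)) :
    localDirichletIntegral ζ k f = localDirichletIntegral ζ k g := by
  rw [localDirichletIntegral_eq (mem_ball_zero_iff.1 hζ),
    localDirichletIntegral_eq (mem_ball_zero_iff.1 hζ)]
  refine lintegral_areaMeasure_congr fun z hz => ?_
  rw [(Filter.eventuallyEq_of_mem (isOpen_ball.mem_nhds hz) h).iteratedDeriv_eq]

lemma localDirichletIntegral_sub_const (hζ : ζ ∈ ball (0 : ℂ) 1) (m : ℕ) (f : ℂ → ℂ) (a : ℂ) :
    localDirichletIntegral ζ (m + 1) (fun z => f z - a) = localDirichletIntegral ζ (m + 1) f := by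
  have : iteratedDeriv (m + 1) (fun z => f z - a) = iteratedDeriv (m + 1) f := by
    rw [iteratedDeriv_succ', iteratedDeriv_succ']
    congr 1
    ext z
    simp
  rw [localDirichletIntegral_eq (mem_ball_zero_iff.1 hζ),
    localDirichletIntegral_eq (mem_ball_zero_iff.1 hζ), this]

/-- Transport of `D_{ζ,m+1}((z - ζ) g)` to the origin; `H` is `g` composed with the disc
automorphism, with the weight `q ^ (m - 1)`, where `q` is the denominator of the automorphism. -/
lemma localDirichletIntegral_sub_mul (hζ : ζ ∈ ball (0 : ℂ) 1) {g H : ℂ → ℂ}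
    (hg : DifferentiableOn ℂ g (ball 0 1)) (hH : DifferentiableOn ℂ H (ball 0 1)) (m : ℕ)
    (h : ∀ w ∈ ball (0 : ℂ) 1, (1 + conj ζ * w) ^ m * g (mobius ζ w) = (1 + conj ζ * w) * H w) :
    localDirichletIntegral ζ (m + 1) (fun z => (z - ζ) * g z)
      = ENNReal.ofReal ((1 - ‖ζ‖ ^ 2) ^ (m + 1))⁻¹ *
        (ENNReal.ofReal ((1 - ‖ζ‖ ^ 2) ^ 2) * circleDirichletIntegral m H) := by
  have hc := one_sub_norm_sq_pos hζ
  rw [localDirichletIntegral_mobius hζ (DifferentiableOn.fun_mul (by fun_prop) hg)]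
  congr 1
  rw [localDirichletIntegral_congr (mem_ball_self one_pos) (m + 1)
    (g := fun w => w * (((1 - ‖ζ‖ ^ 2 : ℝ) : ℂ) * H w)), localDirichletIntegral_zero (hH.const_mul _),
    circleDirichletIntegral_const_mul hH, enorm_sq_eq_ofReal, Complex.norm_real,
    Real.norm_of_nonneg hc.le]
  intro w hw
  have hq := denom_ne_zero hζ hw
  have h1 := h w hw
  simp only
  rw [mobius_sub hζ hw]
  generalize 1 + conj ζ * w = q at *
  field_simp
  linear_combination (w * ((1 - ‖ζ‖ ^ 2 : ℝ) : ℂ)) * h1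

end HigherDirichlet

end

theorem theorem3 (k : ℕ) (hk : 1 ≤ k) (ζ : ℂ) (hζ : ζ ∈ Metric.ball (0 : ℂ) 1)
    (f : ℂ → ℂ) (hf : DifferentiableOn ℂ f (Metric.ball (0 : ℂ) 1)) :
    HigherDirichlet.localDirichletIntegral ζ k f =
      HigherDirichlet.circleDirichletIntegral (k - 1) (dslope f ζ) := by
  open HigherDirichlet in
  obtain ⟨m, rfl⟩ := Nat.exists_eq_add_of_le' hk
  have hg : DifferentiableOn ℂ (dslope f ζ) (Metric.ball 0 1) :=
    (Complex.differentiableOn_dslope (Metric.isOpen_ball.mem_nhds hζ)).2 hf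
  have hc := one_sub_norm_sq_pos hζ
  have hfg : (fun z => f z - f ζ) = fun z => (z - ζ) * dslope f ζ z := by
    ext z
    exact (sub_smul_dslope f ζ z).symm
  rw [Nat.add_sub_cancel, ← localDirichletIntegral_sub_const hζ m f (f ζ), hfg]
  -- The weight q^(m-1) in H is q⁻¹ for m = 0, where the Hardy norm replaces an area integral.
  cases m with
  | zero =>
    have hH : DifferentiableOn ℂ
        (fun w => (1 + (starRingEnd ℂ) ζ * w)⁻¹ * dslope f ζ (mobius ζ w)) (Metric.ball 0 1) :=
      DifferentiableOn.fun_mul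
        (DifferentiableOn.fun_inv (by fun_prop) fun w hw => denom_ne_zero hζ hw)
        (differentiableOn_comp_mobius hζ hg)
    rw [localDirichletIntegral_sub_mul hζ hg hH 0 fun w hw => by
      rw [pow_zero, one_mul, mul_inv_cancel_left₀ (denom_ne_zero hζ hw)]]
    simp only [circleDirichletIntegral, if_true]
    rw [hardyNormSq_mobius hζ hg, ← mul_assoc, ← ENNReal.ofReal_mul (by positivity)]
    congr 2
    field_simp
    ring
  | succ m =>
    have hH : DifferentiableOn ℂ
        (fun w => (1 + (starRingEnd ℂ) ζ * w) ^ m * dslope f ζ (mobius ζ w)) (Metric.ball 0 1) :=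
      DifferentiableOn.fun_mul (by fun_prop) (differentiableOn_comp_mobius hζ hg)
    rw [localDirichletIntegral_sub_mul hζ hg hH (m + 1) fun w hw => by ring,
      circleDirichletIntegral_mobius hζ hg, ← mul_assoc, ← mul_assoc,
      ← ENNReal.ofReal_mul (by positivity), ← ENNReal.ofReal_mul (by positivity)]
    -- The three powers of c come from the transport, from |c|² in c w H, and from the covariance of
    -- D_{σ,m+1}.
    have : ((1 - ‖ζ‖ ^ 2) ^ (m + 1 + 1))⁻¹ * (1 - ‖ζ‖ ^ 2) ^ 2 * (1 - ‖ζ‖ ^ 2) ^ m = 1 := by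
      generalize 1 - ‖ζ‖ ^ 2 = c at *
      field_simp
      ring
    rw [this, ENNReal.ofReal_one, one_mul]
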